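/- **Theorem (Bias error on $P_h$ when using the frequency-lifted reformulation).** *Setting.* Let $F\ge 1$. The high-rate plant $P_h$ and the low-rate controller $K_l$ are finite-dimensional real LTI systems with realizations $(A,B,C,D)$ and $(A_K,B_K,C_K,D_K)$, interconnected as $$x[t+1]=Ax[t]+Bu[t],\quad y[t]=Cx[t]+Du[t],\quad u[t]=r[t]-w[\lfloor t/F\rfloor],$$ $$x_K[l+1]=A_Kx_K[l]+B_Ky[lF],\quad w[l]=C_Kx_K[l]+D_Ky[lF]$$ (downsampling of $y$, zero-order hold of $w$). The loop is well posed ($I+D_KD$ invertible) and $K_l$ stabilizes it (the transition matrix over one period has all eigenvalues in the open unit disc). Let $S:r\mapsto u$ and $J:r\mapsto y$ be the closed-loop $F$-periodic systems. For such a system $G$ with time-lifted transfer function $\underline G$, the frequency-lifted representation is $\tilde G(z)=M(z)\,\underline G(z^F)\,M(z)^{-1}$, where $M(z)$ has blocks $(z\phi^{f})^{-q}I$, $0\le f,q<F$, and $\phi=e^{2\pi j/F}$; $\tilde P$ is that of $P_h$. Frequencies are normalized, $z=e^{j\omega}$. *Experiment.* A record of $N=FL$ samples of the loop is taken, from arbitrary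 initial states, with known excitation $r$ and with integrable zero-mean noise added to the records of $u$ and $y$; $\mathbb E$ is the expectation over the noise. DFTs carry the factor $1/\sqrt N$, $\omega_k=2\pi k/N$, and a frequency-lifted DFT is $\tilde V(k)=[V(k)^\top\ V(k+L)^\top\cdots V(k+(F-1)L)^\top]^\top$. The local polynomial method (LPM) of degree $R$ and half-width $n$ maps output data $Y$ to $$\mathrm{LPM}_k(Y)=[Y(k-n)\cdots Y(k+n)]\,W_k,\qquad W_k=K_n^H(K_nK_n^H)^{-1}[I\ 0\cdots 0]^\top,$$ where the column of $K_n$ for the offset $r\in\{-n,\dots,n\}$ is $\big[K_1(r)\otimes\tilde R(k+r);\,K_1(r)\big]$, $K_1(r)=[1,r,\dots,r^R]^\top$. It yields the estimates $\widehat{\tilde S}$ and $\widehat{\tilde J}$ from the lifted records of $u$ and $y$. Put $\widehat{\tilde P}=\widehat{\tilde J}\,\widehat{\tilde S}^{-1}$ and, for a freely chosen $p\in\{0,\dots,F-1\}$, $$\widehat{P_h}(e^{j\omega_k})=\widehat{\tilde P}(e^{j\omega_k}\phi^{-p})_{[p+1,p+1]}$$ (blocks; $e^{j\omega_k}\phi^{-p}=e^{j\omega_m}$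 with $m=k-pL$). *Interpolation and leakage errors.* Let $\delta$ be the initial minus the final state $(x,x_K)$ of the loop. For $X\in\{S,J\}$ with time-lifted closed-loop realization $(\mathcal A,\mathcal B,\mathcal C,\mathcal D)$ let $T_X(\omega)=N^{-1/2}M(z)\,\mathcal C(z^FI-\mathcal A)^{-1}z^F\delta$, $z=e^{j\omega}$, be its transient. For a function $f$ of the frequency let $\rho_k f(\omega)$ be $f(\omega)$ minus its Taylor polynomial of degree $R$ at $\omega_k$. Set $$X_{\mathrm{int}}(k)=\mathrm{LPM}_k\big(m'\mapsto\rho_k\tilde X(\omega_{m'})\,\tilde R(m')\big),\quad X_{\mathrm{leak}}(k)=\mathrm{LPM}_k\big(m'\mapsto\rho_kT_X(\omega_{m'})\big),\quad X_\Delta=X_{\mathrm{int}}+X_{\mathrm{leak}} .$$ Matrix norms are maximal absolute row sums, vector norms are maximum norms. *Claim.* There is a constant $C$, depending only on the two realizations, $F$ and $R$, such that for every such experiment, every $n$, every $p$ and every bin $k$, with $m=k-pL$, the following holds. 1. If $K_nK_n^H$ is invertible at bin $m$, then for $X\in\{S,J\}$ the estimate at $m$ is integrable and $\mathbb E\,\widehat{\tilde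 X}(m)-\tilde X(m)=X_\Delta(m)$: the LPM bias consists of interpolation and leakage error only. Moreover, with $w_r$ the row of $W_m$ for the offset $r$, $\gamma_{\rm int}=\sum_r\|\tilde R(m+r)\|\,\|w_r\|_1$ and $\gamma_{\rm leak}=\sum_r\|w_r\|_1$, $$\|X_{\mathrm{int}}(m)\|\le C\,\gamma_{\rm int}\,\sup_{\omega\in[\omega_{m-n},\omega_{m+n}]}\|\tilde X^{(R+1)}(\omega)\|\,(n/N)^{R+1},\qquad \|X_{\mathrm{leak}}(m)\|\le C\,\frac{\gamma_{\rm leak}\|\delta\|}{\sqrt N}\,(n/N)^{R+1},$$ so that $\|X_{\mathrm{leak}}(m)\|\le C\,c\,(n/N)^{R+2}$ whenever $\gamma_{\rm leak}\|\delta\|/\sqrt N\le c\,n/N$. 2. Suppose moreover that no $e^{j\omega_k}\phi^f$ ($0\le f<F$) is an eigenvalue of $A$, that $\tilde S(m)$ is invertible, that $\widehat{\tilde S}(m)$ is almost surely invertible, and that $\|\widehat{\tilde S}(m)^{-1}\|\,e^2$ is integrable, where $e=\|\widehat{\tilde J}(m)-\tilde J(m)\|+\|\widehat{\tilde S}(m)-\tilde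 S(m)\|$. Then $\widehat{P_h}(e^{j\omega_k})$ is integrable and, up to terms of second order in the estimation error, $$\mathbb E\big(\widehat{P_h}(e^{j\omega_k})\big)-P_h(e^{j\omega_k})\approx\Big(\big(J_\Delta-\tilde P\,S_\Delta\big)\tilde S^{-1}\Big)_{[p+1,p+1]}\Big|_{e^{j\omega_k}\phi^{-p}} ;$$ precisely, the norm of the difference of the two sides is at most $(1+\|\tilde P(m)\|)\,\|\tilde S(m)^{-1}\|\;\mathbb E\big[\|\widehat{\tilde S}(m)^{-1}\|e^2\big]$, and it is at most $2(1+\|\tilde P(m)\|)\,\|\tilde S(m)^{-1}\|^2\,\mathbb E[e^2]$ if $\|\tilde S(m)^{-1}\|\,\|\widehat{\tilde S}(m)-\tilde S(m)\|\le\frac12$ almost surely. 3. A single frequency of the lifted errors affects only a single frequency of $P_h$: if $S_\Delta$ and $J_\Delta$ are changed only at bins congruent to $m_0$ modulo $N$, then the bias expression in 2, as a function of $k$, changes at most at the bins $k\equiv m_0+pL$ modulo $N$. -/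

import Mathlib

open Matrix MeasureTheory

attribute [local instance] Matrix.linftyOpNormedAddCommGroup

noncomputable section

namespace Multirate

/-! ## Rational systems and lifting -/

/-- A finite-dimensional real discrete-time system
`x[t+1] = A x[t] + B u[t]`, `y[t] = C x[t] + D u[t]`. -/
structure StateSpace (σ ι o : Type*) where
  A : Matrix σ σ ℝ
  B : Matrix σ ι ℝ
  C : Matrix o σ ℝ
  D : Matrix o ι ℝ

/-- A real matrix seen as a complex one. -/
def cplx {m n : Type*} (X : Matrix m n ℝ) : Matrix m n ℂ := X.map fun x : ℝ => (x : ℂ)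

/-- The transfer function `C (z I - A)⁻¹ B + D`. -/
def StateSpace.transfer {σ ι o : Type*} [Fintype σ] [DecidableEq σ]
    (G : StateSpace σ ι o) (z : ℂ) : Matrix o ι ℂ :=
  cplx G.C * (z • (1 : Matrix σ σ ℂ) - cplx G.A)⁻¹ * cplx G.B + cplx G.D

/-- The time-lifted system: input and output collect the `F` samples of one period,
`(p, i)` being component `i` of sample `p` of the period; the state is the state at the
beginning of the period. -/
def StateSpace.timeLift {σ ι o : Type*} [Fintype σ] [DecidableEq σ] (F : ℕ)
    (G : StateSpace σ ι o) : StateSpace σ (Fin F × ι) (Fin F × o) where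
  A := G.A ^ F
  B := Matrix.of fun s b => (G.A ^ (F - 1 - (b.1 : ℕ)) * G.B) s b.2
  C := Matrix.of fun a s => (G.C * G.A ^ (a.1 : ℕ)) a.2 s
  D := Matrix.of fun a b =>
    if (b.1 : ℕ) < a.1 then (G.C * G.A ^ ((a.1 : ℕ) - b.1 - 1) * G.B) a.2 b.2
    else if b.1 = a.1 then G.D a.2 b.2 else 0

/-- `φ = exp(2πj/F)`. -/
def phi (F : ℕ) : ℂ := Complex.exp (2 * Real.pi * Complex.I / F)

/-- The modulation matrix `M(z)`, with block `(f, q)` equal to `(z φ ^ f)^(-q) I`. It takes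
the z-transform at `z ^ F` of a time-lifted signal to the frequency-lifted signal at `z`. -/
def modulation (F : ℕ) (ι : Type*) [DecidableEq ι] (z : ℂ) :
    Matrix (Fin F × ι) (Fin F × ι) ℂ :=
  Matrix.of fun a b => if a.2 = b.2 then ((z * phi F ^ (a.1 : ℕ))⁻¹) ^ (b.1 : ℕ) else 0

/-- The frequency-lifted representation `M(z) G(z ^ F) M(z)⁻¹` of the system whose time-lifted
transfer function is `G`. -/
def freqLift (F : ℕ) {ι o : Type*} [Fintype ι] [DecidableEq ι] [Fintype o] [DecidableEq o]
    (G : ℂ → Matrix (Fin F × o) (Fin F × ι) ℂ) (z : ℂ) : Matrix (Fin F × o) (Fin F × ι) ℂ :=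
  modulation F o z * G (z ^ F) * (modulation F ι z)⁻¹

/-! ## The multirate feedback loop -/

/-- The downsampler in time-lifted form: keep the first sample of each period. -/
def downsampler (F : ℕ) (υ : Type*) [DecidableEq υ] : Matrix υ (Fin F × υ) ℝ :=
  Matrix.of fun i b => if (b.1 : ℕ) = 0 ∧ b.2 = i then 1 else 0

/-- The zero-order hold in time-lifted form: repeat the low-rate sample `F` times. -/
def zeroOrderHold (F : ℕ) (μ : Type*) [DecidableEq μ] : Matrix (Fin F × μ) μ ℝ :=
  Matrix.of fun a j => if a.2 = j then 1 else 0

/-- The time-lifted series connection of downsampler, low-rate controller and hold. -/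
def heldController (F : ℕ) {κ μ υ : Type*} [Fintype μ] [DecidableEq μ] [Fintype υ]
    [DecidableEq υ] (K : StateSpace κ υ μ) : StateSpace κ (Fin F × υ) (Fin F × μ) where
  A := K.A
  B := K.B * downsampler F υ
  C := zeroOrderHold F μ * K.C
  D := zeroOrderHold F μ * K.D * downsampler F υ

/-- The matrix `(I + D_Q D_G)⁻¹` that resolves the direct feedthrough of the loop
`u = r - Q y`, `y = G u`. -/
def loopGain {σ κ a b : Type*} [Fintype a] [DecidableEq a] [Fintype b]
    (G : StateSpace σ a b) (Q : StateSpace κ b a) : Matrix a a ℝ :=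
  (1 + Q.D * G.D)⁻¹

/-- The system `r ↦ u` of the loop `u = r - Q y`, `y = G u`, that is, `(I + Q G)⁻¹`, in the
state (state of `G`, state of `Q`). -/
def sensitivity {σ κ a b : Type*} [Fintype σ] [Fintype κ] [Fintype a] [DecidableEq a] [Fintype b]
    (G : StateSpace σ a b) (Q : StateSpace κ b a) : StateSpace (σ ⊕ κ) a a where
  A := Matrix.fromBlocks
    (G.A - G.B * loopGain G Q * Q.D * G.C)
    (-(G.B * loopGain G Q * Q.C))
    (Q.B * (G.C - G.D * loopGain G Q * Q.D * G.C))
    (Q.A - Q.B * G.D * loopGain G Q * Q.C)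
  B := Matrix.fromRows (G.B * loopGain G Q) (Q.B * G.D * loopGain G Q)
  C := Matrix.fromCols (-(loopGain G Q * Q.D * G.C)) (-(loopGain G Q * Q.C))
  D := loopGain G Q

/-- The system `r ↦ y` of the same loop, that is, `(I + G Q)⁻¹ G`, in the same state. -/
def processSensitivity {σ κ a b : Type*} [Fintype σ] [Fintype κ] [Fintype a] [DecidableEq a]
    [Fintype b] (G : StateSpace σ a b) (Q : StateSpace κ b a) : StateSpace (σ ⊕ κ) a b where
  A := (sensitivity G Q).A
  B := (sensitivity G Q).B
  C := Matrix.fromCols (G.C - G.D * loopGain G Q * Q.D * G.C) (-(G.D * loopGain G Q * Q.C))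
  D := G.D * loopGain G Q

section Loop

variable {σ κ μ υ : Type*} [Fintype σ] [DecidableEq σ] [Fintype κ] [DecidableEq κ]
  [Fintype μ] [DecidableEq μ] [Fintype υ] [DecidableEq υ]

/-- Time-lifted `S_LPTV : r ↦ u`. -/
def liftedS (F : ℕ) (P : StateSpace σ μ υ) (K : StateSpace κ υ μ) :
    StateSpace (σ ⊕ κ) (Fin F × μ) (Fin F × μ) :=
  sensitivity (P.timeLift F) (heldController F K)

/-- Time-lifted `J_LPTV : r ↦ y`. -/
def liftedJ (F : ℕ) (P : StateSpace σ μ υ) (K : StateSpace κ υ μ) :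
    StateSpace (σ ⊕ κ) (Fin F × μ) (Fin F × υ) :=
  processSensitivity (P.timeLift F) (heldController F K)

/-- The controller stabilizes the multirate loop: the transition matrix over one period has
all its eigenvalues in the open unit disc. -/
def Stabilizes (F : ℕ) (P : StateSpace σ μ υ) (K : StateSpace κ υ μ) : Prop :=
  ∀ ev ∈ spectrum ℂ (cplx (liftedS F P K).A), ‖ev‖ < 1

/-! ## Frequencies and Fourier transforms -/

/-- Normalized frequency `2πk/N` of bin `k`. -/
def binFreq (N : ℕ) (k : ℤ) : ℝ := 2 * Real.pi * k / N

/-- The point `exp(jθ)` of the unit circle. -/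
def circ (θ : ℝ) : ℂ := Complex.exp (θ * Complex.I)

/-- Frequency-lifted frequency response, as a function of the frequency, of the system with
time-lifted realization `G`. -/
def liftedFRF (F : ℕ) {s ι o : Type*} [Fintype s] [DecidableEq s] [Fintype ι] [DecidableEq ι]
    [Fintype o] [DecidableEq o] (G : StateSpace s (Fin F × ι) (Fin F × o)) (θ : ℝ) :
    Matrix (Fin F × o) (Fin F × ι) ℂ :=
  freqLift F G.transfer (circ θ)

/-- The discrete Fourier transform of the first `N` samples, with the factor `1/√N`. -/
def dft (N : ℕ) {ι : Type*} (v : ℕ → ι → ℝ) (k : ℤ) : ι → ℂ := fun i =>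
  (1 / (Real.sqrt N : ℂ)) *
    ∑ t ∈ Finset.range N, (v t i : ℂ) * Complex.exp (-(2 * Real.pi * Complex.I * t * k / N))

/-- The frequency-lifted transform of a record of `F * L` samples: multiplication of
`exp(jω)` by `φ` is a shift by `L` bins. -/
def liftedDFT (F L : ℕ) {ι : Type*} (v : ℕ → ι → ℝ) (k : ℤ) : Fin F × ι → ℂ := fun a =>
  dft (F * L) v (k + (a.1 : ℕ) * L) a.2

/-! ## Local polynomial modeling -/

/-- Offset in `{-n, …, n}` of the `i`-th bin of the window. -/
def offset (n : ℕ) (i : Fin (2 * n + 1)) : ℤ := (i : ℤ) - n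

/-- The regressor matrix `K_n` at bin `k`; its columns are
`[K₁(r) ⊗ U(k+r); K₁(r)]` with `K₁(r) = [1, r, …, r ^ R]ᵀ`. -/
def regressor (R n : ℕ) {α : Type*} (U : ℤ → α → ℂ) (k : ℤ) :
    Matrix ((Fin (R + 1) × α) ⊕ Fin (R + 1)) (Fin (2 * n + 1)) ℂ :=
  Matrix.of fun row i => Sum.elim
    (fun a => (offset n i : ℂ) ^ (a.1 : ℕ) * U (k + offset n i) a.2)
    (fun s => (offset n i : ℂ) ^ (s : ℕ)) row

/-- `[I 0 ⋯ 0]ᵀ`. -/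
def selector (R : ℕ) (α : Type*) [DecidableEq α] :
    Matrix ((Fin (R + 1) × α) ⊕ Fin (R + 1)) α ℂ :=
  Matrix.of fun row b => Sum.elim
    (fun a => if (a.1 : ℕ) = 0 ∧ a.2 = b then 1 else 0) (fun _ => 0) row

/-- The matrix `K_nᴴ (K_n K_nᴴ)⁻¹ [I 0 ⋯ 0]ᵀ`. -/
def lpmWeights (R n : ℕ) {α : Type*} [Fintype α] [DecidableEq α] (U : ℤ → α → ℂ) (k : ℤ) :
    Matrix (Fin (2 * n + 1)) α ℂ :=
  (regressor R n U k)ᴴ * (regressor R n U k * (regressor R n U k)ᴴ)⁻¹ * selector R α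

/-- The least-squares LPM estimate at bin `k` from input data `U` and output data `Y`. -/
def lpm (R n : ℕ) {α β : Type*} [Fintype α] [DecidableEq α] (U : ℤ → α → ℂ) (Y : ℤ → β → ℂ)
    (k : ℤ) : Matrix β α ℂ :=
  (Matrix.of fun b i => Y (k + offset n i) b : Matrix β (Fin (2 * n + 1)) ℂ) *
    lpmWeights R n U k

/-- The least-squares problem at bin `k` has a unique solution. -/
def Exciting (R n : ℕ) {α : Type*} [Fintype α] [DecidableEq α] (U : ℤ → α → ℂ) (k : ℤ) : Prop :=
  IsUnit (regressor R n U k * (regressor R n U k)ᴴ).det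

/-- Gain from a relative output error in the window to the estimate. -/
def interpGain (R n : ℕ) {α : Type*} [Fintype α] [DecidableEq α] (U : ℤ → α → ℂ) (k : ℤ) : ℝ :=
  ∑ i, ‖U (k + offset n i)‖ * ∑ a, ‖lpmWeights R n U k i a‖

/-- Gain from an absolute output error in the window to the estimate. -/
def leakGain (R n : ℕ) {α : Type*} [Fintype α] [DecidableEq α] (U : ℤ → α → ℂ) (k : ℤ) : ℝ :=
  ∑ i, ∑ a, ‖lpmWeights R n U k i a‖

/-- Remainder of the Taylor polynomial of degree `R` of `f` at `c`, evaluated at `c + h`. -/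
def taylorRem (R : ℕ) (f : ℝ → ℂ) (c h : ℝ) : ℂ :=
  f (c + h) - ∑ s ∈ Finset.range (R + 1), iteratedDeriv s f c / (s.factorial : ℂ) * (h : ℂ) ^ s

/-- The interpolation error: what LPM makes, in a record of `N` samples, of the part of
`G(ω) U` that is not matched by a local polynomial of degree `R` for `G`. -/
def interpError (R n N : ℕ) {α β : Type*} [Fintype α] [DecidableEq α] (U : ℤ → α → ℂ)
    (G : ℝ → Matrix β α ℂ) (k : ℤ) : Matrix β α ℂ :=
  lpm R n U
    (fun m => (Matrix.of fun b a =>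
      taylorRem R (fun θ => G θ b a) (binFreq N k) (binFreq N (m - k))) *ᵥ U m) k

/-- The leakage error: what LPM makes of the part of the transient `T(ω)` that is not
matched by a local polynomial of degree `R`. -/
def leakError (R n N : ℕ) {α β : Type*} [Fintype α] [DecidableEq α] (U : ℤ → α → ℂ)
    (T : ℝ → β → ℂ) (k : ℤ) : Matrix β α ℂ :=
  lpm R n U
    (fun m b => taylorRem R (fun θ => T θ b) (binFreq N k) (binFreq N (m - k))) k

/-- The transient contribution, in a record of `N` samples, to the frequency-lifted output of
the system with time-lifted realization `G`, when `δ` is the initial minus the final state. -/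
def transient (F N : ℕ) {s ι o : Type*} [Fintype s] [DecidableEq s] [Fintype o] [DecidableEq o]
    (G : StateSpace s (Fin F × ι) (Fin F × o)) (δ : s → ℝ) (θ : ℝ) : Fin F × o → ℂ :=
  (1 / (Real.sqrt N : ℂ)) • (modulation F o (circ θ) *ᵥ (cplx G.C *ᵥ
    ((circ θ ^ F • (1 : Matrix s s ℂ) - cplx G.A)⁻¹ *ᵥ (circ θ ^ F • fun i => (δ i : ℂ)))))

/-- Entrywise `s`-th derivative with respect to the frequency. -/
def matDeriv (s : ℕ) {α β : Type*} (G : ℝ → Matrix β α ℂ) (θ : ℝ) : Matrix β α ℂ :=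
  Matrix.of fun b a => iteratedDeriv s (fun t => G t b a) θ

/-! ## The identification experiment -/

/-- One experiment of `F * L` samples on the multirate loop: a known excitation `r`, signals
that satisfy the equations of the loop from arbitrary initial states, and zero-mean noise on
the recorded input and output of the plant. -/
structure Experiment (F : ℕ) (P : StateSpace σ μ υ) (K : StateSpace κ υ μ)
    {Ω : Type*} [MeasurableSpace Ω] (ℙ : Measure Ω) where
  /-- number of periods in the record -/
  L : ℕ
  L_pos : 0 < L
  /-- excitation -/
  r : ℕ → μ → ℝ
  /-- plant state, input and output (high rate) -/
  x : ℕ → σ → ℝ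
  u : ℕ → μ → ℝ
  y : ℕ → υ → ℝ
  /-- controller state and output (low rate) -/
  xK : ℕ → κ → ℝ
  w : ℕ → μ → ℝ
  x_succ : ∀ t, x (t + 1) = P.A *ᵥ x t + P.B *ᵥ u t
  y_eq : ∀ t, y t = P.C *ᵥ x t + P.D *ᵥ u t
  xK_succ : ∀ l, xK (l + 1) = K.A *ᵥ xK l + K.B *ᵥ y (l * F)
  w_eq : ∀ l, w l = K.C *ᵥ xK l + K.D *ᵥ y (l * F)
  u_eq : ∀ t, u t = r t - w (t / F)
  /-- noise on the records of `u` and `y` -/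
  vu : ℕ → Ω → μ → ℝ
  vy : ℕ → Ω → υ → ℝ
  vu_integrable : ∀ t i, Integrable (fun ω => vu t ω i) ℙ
  vy_integrable : ∀ t i, Integrable (fun ω => vy t ω i) ℙ
  vu_mean : ∀ t i, ∫ ω, vu t ω i ∂ℙ = 0
  vy_mean : ∀ t i, ∫ ω, vy t ω i ∂ℙ = 0

namespace Experiment

variable {F : ℕ} {P : StateSpace σ μ υ} {K : StateSpace κ υ μ} {Ω : Type*} [MeasurableSpace Ω]
  {ℙ : Measure Ω}

/-- Number of samples. -/
def N (E : Experiment F P K ℙ) : ℕ := F * E.L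

/-- Frequency-lifted excitation. -/
def rLift (E : Experiment F P K ℙ) : ℤ → Fin F × μ → ℂ := liftedDFT F E.L E.r

/-- LPM estimate of the frequency-lifted `S`. -/
def SHat (E : Experiment F P K ℙ) (R n : ℕ) (ω : Ω) (k : ℤ) : Matrix (Fin F × μ) (Fin F × μ) ℂ :=
  lpm R n E.rLift (liftedDFT F E.L fun t => E.u t + E.vu t ω) k

/-- LPM estimate of the frequency-lifted `J`. -/
def JHat (E : Experiment F P K ℙ) (R n : ℕ) (ω : Ω) (k : ℤ) : Matrix (Fin F × υ) (Fin F × μ) ℂ :=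
  lpm R n E.rLift (liftedDFT F E.L fun t => E.y t + E.vy t ω) k

/-- Estimate of the frequency-lifted plant. -/
def PHat (E : Experiment F P K ℙ) (R n : ℕ) (ω : Ω) (k : ℤ) : Matrix (Fin F × υ) (Fin F × μ) ℂ :=
  E.JHat R n ω k * (E.SHat R n ω k)⁻¹

/-- Initial minus final state of the loop. -/
def stateGap (E : Experiment F P K ℙ) : σ ⊕ κ → ℝ :=
  Sum.elim (E.x 0 - E.x E.N) (E.xK 0 - E.xK E.L)

/-- True frequency-lifted responses at bin `k`. -/
def STrue (E : Experiment F P K ℙ) (k : ℤ) : Matrix (Fin F × μ) (Fin F × μ) ℂ :=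
  liftedFRF F (liftedS F P K) (binFreq E.N k)

def JTrue (E : Experiment F P K ℙ) (k : ℤ) : Matrix (Fin F × υ) (Fin F × μ) ℂ :=
  liftedFRF F (liftedJ F P K) (binFreq E.N k)

def PTrue (E : Experiment F P K ℙ) (k : ℤ) : Matrix (Fin F × υ) (Fin F × μ) ℂ :=
  liftedFRF F (P.timeLift F) (binFreq E.N k)

/-- LPM interpolation error on the system with time-lifted realization `G`. -/
def interp (E : Experiment F P K ℙ) (R n : ℕ) {o : Type*} [Fintype o] [DecidableEq o]
    (G : StateSpace (σ ⊕ κ) (Fin F × μ) (Fin F × o)) (k : ℤ) : Matrix (Fin F × o) (Fin F × μ) ℂ :=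
  interpError R n E.N E.rLift (liftedFRF F G) k

/-- LPM leakage error on the system with time-lifted realization `G`. -/
def leak (E : Experiment F P K ℙ) (R n : ℕ) {o : Type*} [Fintype o] [DecidableEq o]
    (G : StateSpace (σ ⊕ κ) (Fin F × μ) (Fin F × o)) (k : ℤ) : Matrix (Fin F × o) (Fin F × μ) ℂ :=
  leakError R n E.N E.rLift (transient F E.N G E.stateGap) k

/-- `S_Δ` and `J_Δ`: interpolation error plus leakage error. -/
def SDelta (E : Experiment F P K ℙ) (R n : ℕ) (k : ℤ) : Matrix (Fin F × μ) (Fin F × μ) ℂ :=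
  E.interp R n (liftedS F P K) k + E.leak R n (liftedS F P K) k

def JDelta (E : Experiment F P K ℙ) (R n : ℕ) (k : ℤ) : Matrix (Fin F × υ) (Fin F × μ) ℂ :=
  E.interp R n (liftedJ F P K) k + E.leak R n (liftedJ F P K) k

/-- The orders of magnitude of the two errors on `G` at bin `k`, with constant `C`: the
interpolation error is `G^(R+1) O((n/N)^(R+1))`, and the leakage error is `O((n/N)^(R+1))`
times the size of the transient relative to the excitation, hence `O((n/N)^(R+2))` if the
latter is `O(n/N)`. -/
def ErrorOrders (E : Experiment F P K ℙ) (R n : ℕ) {o : Type*} [Fintype o] [DecidableEq o]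
    (G : StateSpace (σ ⊕ κ) (Fin F × μ) (Fin F × o)) (k : ℤ) (C : ℝ) : Prop :=
  (∀ b : ℝ,
    (∀ θ ∈ Set.Icc (binFreq E.N (k - n)) (binFreq E.N (k + n)),
      ‖matDeriv (R + 1) (liftedFRF F G) θ‖ ≤ b) →
    ‖E.interp R n G k‖ ≤ C * interpGain R n E.rLift k * b * ((n : ℝ) / E.N) ^ (R + 1)) ∧
  ‖E.leak R n G k‖ ≤
    C * (leakGain R n E.rLift k * ‖E.stateGap‖ / Real.sqrt E.N) * ((n : ℝ) / E.N) ^ (R + 1) ∧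
  (∀ c : ℝ, leakGain R n E.rLift k * ‖E.stateGap‖ / Real.sqrt E.N ≤ c * ((n : ℝ) / E.N) →
    ‖E.leak R n G k‖ ≤ C * c * ((n : ℝ) / E.N) ^ (R + 2))

/-- Inverse frequency lifting with the choice `p`, on functions of the bin:
the diagonal block with (zero-based) index `p` at `exp(jω) φ ^ (-p)`. -/
def invFreqLift (E : Experiment F P K ℙ) (p : Fin F)
    (G : ℤ → Matrix (Fin F × υ) (Fin F × μ) ℂ) (k : ℤ) : Matrix υ μ ℂ :=
  Matrix.of fun i j => G (k - (p : ℕ) * E.L) (p, i) (p, j)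

/-- Estimate of the high-rate plant at bin `k`. -/
def PhHat (E : Experiment F P K ℙ) (R n : ℕ) (p : Fin F) (ω : Ω) (k : ℤ) : Matrix υ μ ℂ :=
  E.invFreqLift p (E.PHat R n ω) k

/-- The block `((J_Δ - P S_Δ) S⁻¹)_[p+1,p+1]` at `exp(jω) φ ^ (-p)`, for given lifted errors. -/
def biasFormula (E : Experiment F P K ℙ) (p : Fin F)
    (JΔ : ℤ → Matrix (Fin F × υ) (Fin F × μ) ℂ) (SΔ : ℤ → Matrix (Fin F × μ) (Fin F × μ) ℂ)
    (k : ℤ) : Matrix υ μ ℂ :=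
  E.invFreqLift p (fun m => (JΔ m - E.PTrue m * SΔ m) * (E.STrue m)⁻¹) k

/-- Size of the error of the two LPM estimates. -/
def lpmErr (E : Experiment F P K ℙ) (R n : ℕ) (ω : Ω) (k : ℤ) : ℝ :=
  ‖E.JHat R n ω k - E.JTrue k‖ + ‖E.SHat R n ω k - E.STrue k‖

end Experiment

end Loop

/-- Entrywise expectation of a random matrix. -/
def expect {Ω m n : Type*} [MeasurableSpace Ω] (ℙ : Measure Ω) (X : Ω → Matrix m n ℂ) :
    Matrix m n ℂ :=
  Matrix.of fun i j => ∫ ω, X ω i j ∂ℙ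

end Multirate

end

/-! Collecting the samples of each period turns the multirate loop into an ordinary time-invariant
loop with the period as time step. At a bin frequency `z` of the record, `ζ = z ^ F` is an `L`-th
root of unity, so transforming the lifted state equation over the record leaves a single boundary
term, `ζ` times the state gap. Solving with the resolvent gives the exact relation: lifted output
DFT = lifted response times lifted excitation DFT + transient (`liftedDFT_response`). Stability
keeps the resolvent regular on the unit circle, so response and transient are smooth in the
frequency.

LPM is linear in the output data, its weights depend only on the known excitation, and it returns
the constant coefficient on exact local polynomial data (`lpm_eq_of_polynomial`). Subtracting Taylor
polynomials therefore identifies the noiseless error as LPM applied to the Taylor remainders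
(`lpm_eq_add_errors`), and zero-mean noise disappears in expectation. The orders follow from
`norm_taylorRem_le`; for the transient the derivative bound is uniform because its kernel is smooth
and periodic.

For the plant, `J = P S` holds exactly for the lifted responses, and the lifted plant is block
diagonal with blocks `P(z φ ^ f)` (`freqLift_timeLift`). With `ΔJ`, `ΔS` the estimation errors, the
error of the quotient is `(ΔJ - P ΔS) Ŝ⁻¹`; replacing `Ŝ⁻¹` by `S⁻¹` costs a term quadratic in the
errors (`quotient_bias`). Block `p` at `exp(jω) φ ^ (-p)` is the plant at `exp(jω)`, which yields
the bias formula; the formula is pointwise in the bin, hence the last claim. -/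

namespace Multirate

/-! ## Row-sum norm of complex matrices -/

section Norm

variable {m n : Type*} [Fintype m] [Fintype n]

theorem sum_norm_row_le (A : Matrix m n ℂ) (i : m) : ∑ j, ‖A i j‖ ≤ ‖A‖ := by
  have h := Finset.le_sup (f := fun i : m => ∑ j : n, ‖A i j‖₊) (Finset.mem_univ i)
  rw [Matrix.linfty_opNorm_def]
  simpa using NNReal.coe_le_coe.2 h

theorem norm_entry_le (A : Matrix m n ℂ) (i : m) (j : n) : ‖A i j‖ ≤ ‖A‖ :=
  (Finset.single_le_sum (f := fun j => ‖A i j‖) (fun _ _ => norm_nonneg _)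
    (Finset.mem_univ j)).trans (sum_norm_row_le A i)

theorem norm_le_of_sum_norm_row_le (A : Matrix m n ℂ) {c : ℝ} (hc : 0 ≤ c)
    (h : ∀ i, ∑ j, ‖A i j‖ ≤ c) : ‖A‖ ≤ c := by
  lift c to NNReal using hc
  rw [Matrix.linfty_opNorm_def, NNReal.coe_le_coe]
  refine Finset.sup_le fun i _ => ?_
  rw [← NNReal.coe_le_coe]
  simpa using h i

end Norm

/-! ## Taylor remainders -/

/-- Differentiating in the offset cancels `s` against `s!` and shifts the index, so the degree drops
by one. This drives the induction in `norm_taylorRem_le`. -/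
theorem hasDerivAt_taylorRem (R : ℕ) {f : ℝ → ℂ} (hf : ContDiff ℝ 1 f) (c h : ℝ) :
    HasDerivAt (taylorRem (R + 1) f c) (taylorRem R (deriv f) c h) h := by
  have h1 : HasDerivAt (fun h => f (c + h)) (deriv f (c + h)) h := by
    have := (hf.differentiable one_ne_zero (c + h)).hasDerivAt
    simpa using this.comp_const_add c h
  have h2 : HasDerivAt (fun h : ℝ => ∑ s ∈ Finset.range (R + 2),
      iteratedDeriv s f c / (s.factorial : ℂ) * (h : ℂ) ^ s)
      (∑ s ∈ Finset.range (R + 1),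
        iteratedDeriv s (deriv f) c / (s.factorial : ℂ) * (h : ℂ) ^ s) h := by
    have h3 : ∀ s ∈ Finset.range (R + 2), HasDerivAt (fun h : ℝ =>
        iteratedDeriv s f c / (s.factorial : ℂ) * (h : ℂ) ^ s)
        (iteratedDeriv s f c / (s.factorial : ℂ) * (s * (h : ℂ) ^ (s - 1) * 1)) h := by
      intro s _
      exact ((Complex.ofRealCLM.hasDerivAt (x := h)).pow s).const_mul _
    refine (HasDerivAt.fun_sum h3).congr_deriv ?_
    rw [Finset.sum_range_succ' _ (R + 1)]
    simp only [Nat.cast_zero, zero_mul, mul_zero, add_zero]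
    refine Finset.sum_congr rfl fun s _ => ?_
    rw [iteratedDeriv_succ', Nat.factorial_succ]
    have : ((s : ℂ) + 1) ≠ 0 := by exact_mod_cast s.succ_ne_zero
    have h5 : (s.factorial : ℂ) ≠ 0 := by exact_mod_cast s.factorial_ne_zero
    push_cast
    field_simp
  exact h1.sub h2

theorem taylorRem_zero_right (R : ℕ) (f : ℝ → ℂ) (c : ℝ) : taylorRem R f c 0 = 0 := by
  unfold taylorRem
  rw [Finset.sum_range_succ']
  simp

/-- Lagrange's form fails for complex values, so the mean value inequality is iterated: the
remainder vanishes at offset 0 and its derivative is the remainder of `deriv f`. Bounding that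
derivative by its largest value on the interval loses the factor `1/(R+1)!`, which is harmless here.
-/
theorem norm_taylorRem_le (R : ℕ) {f : ℝ → ℂ} (hf : ContDiff ℝ (R + 1) f) {c H b : ℝ}
    (hb : ∀ t, |t| ≤ H → ‖iteratedDeriv (R + 1) f (c + t)‖ ≤ b) {h : ℝ} (hh : |h| ≤ H) :
    ‖taylorRem R f c h‖ ≤ b * |h| ^ (R + 1) := by
  induction R generalizing f h H with
  | zero =>
    have h1 : ∀ x ∈ Set.uIcc 0 h, HasDerivWithinAt (fun t => f (c + t)) (deriv f (c + x))
        (Set.uIcc 0 h) x := fun x _ => by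
      have := ((hf.differentiable (by simp)) (c + x)).hasDerivAt
      exact (this.comp_const_add c x).hasDerivWithinAt
    have h2 := Convex.norm_image_sub_le_of_norm_hasDerivWithin_le (C := b) h1
      (fun x hx => by
        have := hb x ?_
        · simpa using this
        · have := Set.abs_sub_left_of_mem_uIcc hx
          simp only [sub_zero] at this
          exact this.trans hh) (convex_uIcc 0 h)
      Set.left_mem_uIcc Set.right_mem_uIcc
    simpa [taylorRem] using h2
  | succ R ih =>
    have hd : ContDiff ℝ (R + 1) (deriv f) := by
      have := (contDiff_succ_iff_deriv (n := ((R : WithTop ℕ∞) + 1)) (𝕜 := ℝ) (f := f)).1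
        (by exact_mod_cast hf)
      exact this.2.2
    have hle : ∀ x ∈ Set.uIcc 0 h, |x| ≤ |h| := fun x hx => by
      simpa using Set.abs_sub_left_of_mem_uIcc hx
    have h0 : 0 ≤ b := (norm_nonneg _).trans (hb h hh)
    have h2 := Convex.norm_image_sub_le_of_norm_hasDerivWithin_le (C := b * |h| ^ (R + 1))
      (fun x _ => (hasDerivAt_taylorRem R (hf.of_le (by simp)) c x).hasDerivWithinAt)
      (fun x hx => (ih hd (H := H) (fun t ht => by
        rw [← iteratedDeriv_succ']; exact hb t ht) ((hle x hx).trans hh)).trans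
          (by have := hle x hx; gcongr)) (convex_uIcc 0 h)
      Set.left_mem_uIcc Set.right_mem_uIcc
    rw [taylorRem_zero_right, sub_zero, sub_zero, Real.norm_eq_abs] at h2
    rw [pow_succ, ← mul_assoc]
    exact h2

/-! ## Smoothness of matrix functions -/

section Smooth

variable {m n l : Type*} {N : WithTop ℕ∞}

theorem contDiff_matrix_mul [Fintype n] {A : ℝ → Matrix m n ℂ} {B : ℝ → Matrix n l ℂ}
    (hA : ∀ i j, ContDiff ℝ N fun t => A t i j) (hB : ∀ i j, ContDiff ℝ N fun t => B t i j)
    (i : m) (j : l) : ContDiff ℝ N fun t => (A t * B t) i j := by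
  simp only [Matrix.mul_apply]
  exact ContDiff.sum fun k _ => (hA i k).mul (hB k j)

theorem contDiff_matrix_det [Fintype n] [DecidableEq n] {A : ℝ → Matrix n n ℂ}
    (hA : ∀ i j, ContDiff ℝ N fun t => A t i j) : ContDiff ℝ N fun t => (A t).det := by
  simp only [Matrix.det_apply']
  exact ContDiff.sum fun s _ => contDiff_const.mul (contDiff_prod fun i _ => hA _ _)

/-- Cramer's rule: each entry is the inverse determinant times a determinant of a matrix with one
row replaced. -/
theorem contDiff_matrix_inv [Fintype n] [DecidableEq n] {A : ℝ → Matrix n n ℂ}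
    (hA : ∀ i j, ContDiff ℝ N fun t => A t i j) (hdet : ∀ t, (A t).det ≠ 0) (i j : n) :
    ContDiff ℝ N fun t => (A t)⁻¹ i j := by
  simp only [Matrix.inv_def, Matrix.smul_apply, Ring.inverse_eq_inv', smul_eq_mul]
  refine ((contDiff_matrix_det hA).inv hdet).mul ?_
  simp only [Matrix.adjugate_apply]
  refine contDiff_matrix_det fun a b => ?_
  simp only [Matrix.updateRow_apply]
  split_ifs
  · exact contDiff_const
  · exact hA _ _

end Smooth

/-! ## Transfer functions -/

theorem cplx_mul {l m n : Type*} [Fintype m] (X : Matrix l m ℝ) (Y : Matrix m n ℝ) :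
    cplx (X * Y) = cplx X * cplx Y :=
  Matrix.map_mul (f := Complex.ofRealHom)

theorem cplx_add {m n : Type*} (X Y : Matrix m n ℝ) : cplx (X + Y) = cplx X + cplx Y :=
  Matrix.map_add _ (fun _ _ => Complex.ofReal_add _ _) X Y

theorem cplx_one {n : Type*} [DecidableEq n] : cplx (1 : Matrix n n ℝ) = 1 :=
  Matrix.map_one _ Complex.ofReal_zero Complex.ofReal_one

theorem cplx_pow {n : Type*} [Fintype n] [DecidableEq n] (X : Matrix n n ℝ) (k : ℕ) :
    cplx (X ^ k) = cplx X ^ k := by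
  induction k with
  | zero => simp [cplx_one]
  | succ k ih => rw [pow_succ, pow_succ, cplx_mul, ih]

theorem cplx_mulVec {m n : Type*} [Fintype n] (X : Matrix m n ℝ) (v : n → ℝ) :
    (fun i => ((X *ᵥ v) i : ℂ)) = cplx X *ᵥ fun i => (v i : ℂ) := by
  ext i
  simp [Matrix.mulVec, dotProduct, cplx]

section Loop

variable {σ κ a b : Type*} [Fintype σ] [DecidableEq σ] [Fintype κ] [DecidableEq κ]
  [Fintype a] [DecidableEq a] [Fintype b]

/-- In the loop `u = r - Q y`, `y = G u`, the response of `r ↦ y` is that of `r ↦ u`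
followed by `G`. -/
theorem transfer_processSensitivity (G : StateSpace σ a b) (Q : StateSpace κ b a) (z : ℂ)
    (hG : (z • (1 : Matrix σ σ ℂ) - cplx G.A).det ≠ 0)
    (hS : (z • (1 : Matrix (σ ⊕ κ) (σ ⊕ κ) ℂ) - cplx (sensitivity G Q).A).det ≠ 0) :
    (processSensitivity G Q).transfer z = G.transfer z * (sensitivity G Q).transfer z := by
  set E : Matrix σ (σ ⊕ κ) ℝ := Matrix.fromCols 1 0 with hE
  have hA : E * (sensitivity G Q).A = G.A * E + G.B * (sensitivity G Q).C := by
    simp only [hE, sensitivity, ← Matrix.fromCols_fromRows_eq_fromBlocks, Matrix.mul_fromCols,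
      Matrix.fromCols_mul_fromRows]
    ext i (j | j) <;> simp [Matrix.mul_assoc, sub_eq_add_neg]
  have hB : E * (sensitivity G Q).B = G.B * (sensitivity G Q).D := by
    simp only [hE, sensitivity, Matrix.fromCols_mul_fromRows]
    simp
  have hC : (processSensitivity G Q).C = G.C * E + G.D * (sensitivity G Q).C := by
    simp only [hE, sensitivity, processSensitivity, Matrix.mul_fromCols]
    ext i (j | j) <;> simp [Matrix.mul_assoc, sub_eq_add_neg]
  have hD : (processSensitivity G Q).D = G.D * (sensitivity G Q).D := rfl
  have hAB : (processSensitivity G Q).A = (sensitivity G Q).A := rfl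
  have hBB : (processSensitivity G Q).B = (sensitivity G Q).B := rfl
  unfold StateSpace.transfer
  rw [hAB, hBB, hC, hD]
  set S := sensitivity G Q with hSdef
  set X := (z • (1 : Matrix (σ ⊕ κ) (σ ⊕ κ) ℂ) - cplx S.A)⁻¹ * cplx S.B with hX
  set Y := cplx S.C * X + cplx S.D with hY
  have hX1 : (z • (1 : Matrix (σ ⊕ κ) (σ ⊕ κ) ℂ) - cplx S.A) * X = cplx S.B :=
    Matrix.mul_nonsing_inv_cancel_left _ _ (isUnit_iff_ne_zero.2 hS)
  -- The resolvent equation of the loop, projected by `E`, is the state equation of `G` driven by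
  -- `Y`.
  have key : (z • (1 : Matrix σ σ ℂ) - cplx G.A) * (cplx E * X) = cplx G.B * Y := by
    have h1 := congrArg (cplx E * ·) hX1
    simp only [Matrix.sub_mul, Matrix.mul_sub, Matrix.smul_mul, Matrix.one_mul,
      Matrix.mul_smul] at h1
    rw [← Matrix.mul_assoc (cplx E) (cplx S.A), ← cplx_mul, ← cplx_mul, hA, hB, cplx_add, cplx_mul, cplx_mul,
      cplx_mul, Matrix.add_mul, Matrix.mul_assoc, Matrix.mul_assoc] at h1
    rw [Matrix.sub_mul, Matrix.smul_mul, Matrix.one_mul, hY, Matrix.mul_add, ← h1]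
    abel
  have h2 : cplx E * X = (z • (1 : Matrix σ σ ℂ) - cplx G.A)⁻¹ * (cplx G.B * Y) := by
    rw [← key, Matrix.nonsing_inv_mul_cancel_left _ _ (isUnit_iff_ne_zero.2 hG)]
  simp only [Matrix.mul_assoc, cplx_add, cplx_mul, Matrix.add_mul]
  rw [← hX, ← hY, ← h2, hY]
  simp only [Matrix.mul_add]
  abel

end Loop

/-! ## Roots of unity and modulation -/

theorem isPrimitiveRoot_phi {F : ℕ} (hF : 0 < F) : IsPrimitiveRoot (phi F) F :=
  Complex.isPrimitiveRoot_exp F hF.ne'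

theorem phi_ne_zero (F : ℕ) : phi F ≠ 0 := Complex.exp_ne_zero _

theorem mul_phi_pow_pow {F : ℕ} (hF : 0 < F) (z : ℂ) (f : ℕ) :
    (z * phi F ^ f) ^ F = z ^ F := by
  rw [mul_pow, ← pow_mul, mul_comm f, pow_mul, (isPrimitiveRoot_phi hF).pow_eq_one, one_pow,
    mul_one]

/-- `M(z)` is a Vandermonde matrix tensored with the identity; its nodes are distinct because `φ` is
a primitive `F`-th root of unity. -/
theorem det_modulation_ne_zero {F : ℕ} (hF : 0 < F) (ι : Type*) [Fintype ι] [DecidableEq ι]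
    {z : ℂ} (hz : z ≠ 0) : (modulation F ι z).det ≠ 0 := by
  have h : modulation F ι z = Matrix.kroneckerMap (· * ·)
      (Matrix.vandermonde fun f : Fin F => (z * phi F ^ (f : ℕ))⁻¹) (1 : Matrix ι ι ℂ) := by
    ext x y
    simp [modulation, Matrix.vandermonde, Matrix.one_apply]
  rw [h, Matrix.det_kronecker]
  refine mul_ne_zero (pow_ne_zero _ (Matrix.det_vandermonde_ne_zero_iff.2 fun f g hfg => ?_))
    (by simp)
  have := mul_left_cancel₀ hz (inv_injective hfg)
  exact Fin.ext ((isPrimitiveRoot_phi hF).pow_inj f.2 g.2 this)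

theorem modulation_mul_inv {F : ℕ} (hF : 0 < F) (ι : Type*) [Fintype ι] [DecidableEq ι]
    {z : ℂ} (hz : z ≠ 0) : modulation F ι z * (modulation F ι z)⁻¹ = 1 :=
  Matrix.mul_nonsing_inv _ (isUnit_iff_ne_zero.2 (det_modulation_ne_zero hF ι hz))

theorem inv_modulation_mul {F : ℕ} (hF : 0 < F) (ι : Type*) [Fintype ι] [DecidableEq ι]
    {z : ℂ} (hz : z ≠ 0) : (modulation F ι z)⁻¹ * modulation F ι z = 1 :=
  Matrix.nonsing_inv_mul _ (isUnit_iff_ne_zero.2 (det_modulation_ne_zero hF ι hz))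

/-- Frequency lifting is multiplicative. -/
theorem freqLift_eq_mul {F : ℕ} (hF : 0 < F) {ι o p : Type*} [Fintype ι] [DecidableEq ι]
    [Fintype o] [DecidableEq o] [Fintype p] [DecidableEq p]
    {G₁ : ℂ → Matrix (Fin F × o) (Fin F × ι) ℂ} {G₂ : ℂ → Matrix (Fin F × o) (Fin F × p) ℂ}
    {G₃ : ℂ → Matrix (Fin F × p) (Fin F × ι) ℂ} {z : ℂ} (hz : z ≠ 0)
    (h : G₁ (z ^ F) = G₂ (z ^ F) * G₃ (z ^ F)) :
    freqLift F G₁ z = freqLift F G₂ z * freqLift F G₃ z := by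
  unfold freqLift
  rw [h]
  simp only [Matrix.mul_assoc]
  rw [← Matrix.mul_assoc (modulation F p z)⁻¹, inv_modulation_mul hF p hz, Matrix.one_mul]

theorem det_smul_one_sub_ne_zero_iff {n : Type*} [Fintype n] [DecidableEq n] (A : Matrix n n ℂ)
    (z : ℂ) : (z • (1 : Matrix n n ℂ) - A).det ≠ 0 ↔ z ∉ spectrum ℂ A := by
  rw [spectrum.notMem_iff, Matrix.isUnit_iff_isUnit_det, isUnit_iff_ne_zero,
    Algebra.algebraMap_eq_smul_one]

/-- By spectral mapping, if `z ^ F` is an eigenvalue of `A ^ F` it equals `ev ^ F` for some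
eigenvalue `ev` of `A`; then `ev / z` is a power of `φ`. Hence all `F` points `z φ ^ f` have to be
avoided. -/
theorem det_pow_smul_one_sub_pow_ne_zero {F : ℕ} (hF : 0 < F) {n : Type*} [Fintype n]
    [DecidableEq n] (A : Matrix n n ℂ) {z : ℂ} (hz : z ≠ 0)
    (h : ∀ f : Fin F, ((z * phi F ^ (f : ℕ)) • (1 : Matrix n n ℂ) - A).det ≠ 0) :
    (z ^ F • (1 : Matrix n n ℂ) - A ^ F).det ≠ 0 := by
  have : NeZero F := ⟨hF.ne'⟩
  rw [det_smul_one_sub_ne_zero_iff, spectrum.map_pow_of_pos _ hF]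
  rintro ⟨ev, hev, he⟩
  have h1 : (ev / z) ^ F = 1 := by
    rw [div_pow, div_eq_one_iff_eq (pow_ne_zero _ hz)]; exact he
  obtain ⟨i, hi, hi'⟩ := (isPrimitiveRoot_phi hF).eq_pow_of_pow_eq_one h1
  refine (det_smul_one_sub_ne_zero_iff _ _).1 (h ⟨i, hi⟩) ?_
  rw [hi', mul_div_cancel₀ _ hz]
  exact hev

/-! ## Frequency lifting of a time-invariant system -/

/-- With `E = A / w` and `Q = (1 - E)⁻¹`, both sums are geometric, `Q (1 - E ^ N)`. The factor `1 -
E ^ F` of the first cancels the lifted resolvent (`F = q + 1 + n`), and the two `E ^ n` terms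
cancel. The first summand is the response carried over the period boundary, the second the one
within the period. -/
theorem sum_smul_pow_resolvent {s : Type*} [Fintype s] [DecidableEq s] (A : Matrix s s ℂ) {w : ℂ}
    (hw : w ≠ 0) (q n : ℕ)
    (h1 : (w • (1 : Matrix s s ℂ) - A).det ≠ 0)
    (h2 : (w ^ (q + 1 + n) • (1 : Matrix s s ℂ) - A ^ (q + 1 + n)).det ≠ 0) :
    (∑ i ∈ Finset.range (q + 1 + n), w⁻¹ ^ i • A ^ i) *
        (w ^ (q + 1 + n) • (1 : Matrix s s ℂ) - A ^ (q + 1 + n))⁻¹ * A ^ n +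
      w⁻¹ ^ (q + 1) • ∑ j ∈ Finset.range n, w⁻¹ ^ j • A ^ j =
    w⁻¹ ^ q • (w • (1 : Matrix s s ℂ) - A)⁻¹ := by
  set E := w⁻¹ • A with hE
  set Q := w • (w • (1 : Matrix s s ℂ) - A)⁻¹ with hQ
  have hQE : Q * (1 - E) = 1 := by
    have : (1 : Matrix s s ℂ) - E = w⁻¹ • (w • (1 : Matrix s s ℂ) - A) := by
      rw [smul_sub, smul_smul, inv_mul_cancel₀ hw, one_smul]
    rw [this, hQ, Matrix.smul_mul, Matrix.mul_smul, smul_smul, mul_inv_cancel₀ hw, one_smul,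
      Matrix.nonsing_inv_mul _ (isUnit_iff_ne_zero.2 h1)]
  have hgeom : ∀ N, ∑ i ∈ Finset.range N, w⁻¹ ^ i • A ^ i = Q * (1 - E ^ N) := fun N => by
    simp only [← smul_pow]
    rw [← mul_neg_geom_sum, ← Matrix.mul_assoc, hQE, Matrix.one_mul]
  have hF : (1 - E ^ (q + 1 + n)) = w⁻¹ ^ (q + 1 + n) •
      (w ^ (q + 1 + n) • (1 : Matrix s s ℂ) - A ^ (q + 1 + n)) := by
    rw [hE, smul_pow, smul_sub, smul_smul, ← mul_pow, inv_mul_cancel₀ hw, one_pow, one_smul]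
  rw [hgeom, hgeom, hF, Matrix.mul_smul, Matrix.smul_mul,
    Matrix.mul_nonsing_inv_cancel_right _ _ (isUnit_iff_ne_zero.2 h2), hE, smul_pow,
    Matrix.mul_sub, Matrix.smul_mul, Matrix.mul_smul, Matrix.mul_one, smul_sub, smul_smul,
    smul_smul,
    ← pow_add, add_sub_cancel, pow_succ, mul_assoc, inv_mul_cancel₀ hw, mul_one]

section LTI

variable {σ ι o : Type*} [Fintype σ] [DecidableEq σ]

theorem transfer_timeLift_apply (F : ℕ) (G : StateSpace σ ι o) (ζ : ℂ) (q q' : Fin F) (i : o)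
    (j : ι) : (G.timeLift F).transfer ζ (q, i) (q', j) =
      (cplx G.C * (cplx G.A ^ (q : ℕ) * (ζ • (1 : Matrix σ σ ℂ) - cplx G.A ^ F)⁻¹ *
          cplx G.A ^ (F - 1 - (q' : ℕ))) * cplx G.B +
        if (q' : ℕ) < q then cplx G.C * cplx G.A ^ ((q : ℕ) - q' - 1) * cplx G.B
        else if (q : ℕ) = q' then cplx G.D else 0) i j := by
  have h1 : (cplx (G.timeLift F).C * (ζ • (1 : Matrix σ σ ℂ) - cplx (G.timeLift F).A)⁻¹ *
      cplx (G.timeLift F).B) (q, i) (q', j) =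
      (cplx (G.C * G.A ^ (q : ℕ)) * (ζ • (1 : Matrix σ σ ℂ) - cplx (G.A ^ F))⁻¹ *
        cplx (G.A ^ (F - 1 - (q' : ℕ)) * G.B)) i j := rfl
  unfold StateSpace.transfer
  rw [Matrix.add_apply, h1, Matrix.add_apply]
  congr 1
  · simp only [cplx_mul, cplx_pow, Matrix.mul_assoc]
  · simp only [← cplx_pow, ← cplx_mul, StateSpace.timeLift]
    simp only [cplx, Matrix.map_apply, Matrix.of_apply]
    by_cases h : (q' : ℕ) < q
    · simp [h]
    · by_cases h' : q = q'
      · simp [h']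
      · have : (q : ℕ) ≠ q' := fun h => h' (Fin.ext h)
        simp [h, this]
        exact fun h => absurd h.symm h'

/-- For `w = z φ ^ f` this is row `f` of the intertwining relation that block-diagonalizes the
lifted system. -/
theorem sum_inv_pow_mul_transfer_timeLift {F : ℕ} (G : StateSpace σ ι o) {w : ℂ} (hw : w ≠ 0)
    (h1 : (w • (1 : Matrix σ σ ℂ) - cplx G.A).det ≠ 0)
    (h2 : (w ^ F • (1 : Matrix σ σ ℂ) - cplx G.A ^ F).det ≠ 0) (q' : Fin F) (i : o) (j : ι) :
    ∑ q : Fin F, w⁻¹ ^ (q : ℕ) * (G.timeLift F).transfer (w ^ F) (q, i) (q', j) =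
      w⁻¹ ^ (q' : ℕ) * G.transfer w i j := by
  obtain ⟨q', hq'⟩ := q'
  -- The period splits into `q'` samples before the input sample, the sample itself, and `n = F - 1
  -- - q'` samples after it.
  obtain ⟨n, rfl⟩ : ∃ n, F = q' + 1 + n := ⟨F - (q' + 1), by omega⟩
  simp only [transfer_timeLift_apply]
  rw [show q' + 1 + n - 1 - q' = n by omega]
  set Z := (w ^ (q' + 1 + n) • (1 : Matrix σ σ ℂ) - cplx G.A ^ (q' + 1 + n))⁻¹ with hZ
  have h3 := sum_smul_pow_resolvent (cplx G.A) hw q' n h1 h2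
  rw [← hZ] at h3
  -- Causality removes the earlier samples, the sample itself gives `D`, and the later ones give a
  -- partial sum of the impulse response.
  have h4 : ∑ q ∈ Finset.range (q' + 1 + n), w⁻¹ ^ q •
      (if q' < q then cplx G.C * cplx G.A ^ (q - q' - 1) * cplx G.B
        else if q = q' then cplx G.D else 0) =
      w⁻¹ ^ q' • cplx G.D + cplx G.C *
        (w⁻¹ ^ (q' + 1) • ∑ j ∈ Finset.range n, w⁻¹ ^ j • cplx G.A ^ j) * cplx G.B := by
    rw [Finset.sum_range_add, Finset.sum_range_succ, Finset.sum_eq_zero (s := Finset.range q'), zero_add]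
    · congr 1
      · simp
      · simp only [Finset.smul_sum, Matrix.mul_sum, Matrix.sum_mul, smul_smul, ← pow_add,
          Matrix.mul_smul, Matrix.smul_mul]
        refine Finset.sum_congr rfl fun x _ => ?_
        rw [if_pos (by omega), show q' + 1 + x - q' - 1 = x by omega]
    · intro x hx
      have := Finset.mem_range.1 hx
      rw [if_neg (by omega), if_neg (by omega), smul_zero]
  have h5 : ∑ q ∈ Finset.range (q' + 1 + n), w⁻¹ ^ q •
      (cplx G.C * (cplx G.A ^ q * Z * cplx G.A ^ n) * cplx G.B +
      (if q' < q then cplx G.C * cplx G.A ^ (q - q' - 1) * cplx G.B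
        else if q = q' then cplx G.D else 0)) = w⁻¹ ^ q' • G.transfer w := by
    simp only [smul_add, Finset.sum_add_distrib]
    have h6 : ∑ q ∈ Finset.range (q' + 1 + n), w⁻¹ ^ q •
        (cplx G.C * (cplx G.A ^ q * Z * cplx G.A ^ n) * cplx G.B) =
        cplx G.C * ((∑ i ∈ Finset.range (q' + 1 + n), w⁻¹ ^ i • cplx G.A ^ i) * Z *
          cplx G.A ^ n) * cplx G.B := by
      simp only [Matrix.mul_sum, Matrix.sum_mul, Matrix.mul_smul, Matrix.smul_mul]
    rw [h4, h6, add_left_comm, ← Matrix.add_mul, ← Matrix.mul_add, h3]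
    unfold StateSpace.transfer
    rw [smul_add, Matrix.mul_smul, Matrix.smul_mul, add_comm]
  have h7 := congrFun (congrFun h5 i) j
  rw [Matrix.smul_apply, smul_eq_mul] at h7
  rw [← h7, Matrix.sum_apply, ← Finset.sum_range
    (fun q => w⁻¹ ^ q * (cplx G.C * (cplx G.A ^ q * Z * cplx G.A ^ n) * cplx G.B +
      (if q' < q then cplx G.C * cplx G.A ^ (q - q' - 1) * cplx G.B
        else if q = q' then cplx G.D else 0)) i j)]
  rfl

/-- The frequency-lifted representation of a time-invariant system is block diagonal, with the
blocks `G(z φ ^ f)`. -/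
theorem freqLift_timeLift [Fintype ι] [DecidableEq ι] [Fintype o] [DecidableEq o]
    {F : ℕ} (hF : 0 < F) (G : StateSpace σ ι o) {z : ℂ} (hz : z ≠ 0)
    (h : ∀ f : Fin F, ((z * phi F ^ (f : ℕ)) • (1 : Matrix σ σ ℂ) - cplx G.A).det ≠ 0) :
    freqLift F (G.timeLift F).transfer z = Matrix.of fun a b =>
      if a.1 = b.1 then G.transfer (z * phi F ^ (a.1 : ℕ)) a.2 b.2 else 0 := by
  have h2 := det_pow_smul_one_sub_pow_ne_zero hF _ hz h
  set D : Matrix (Fin F × o) (Fin F × ι) ℂ := Matrix.of fun a b =>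
      if a.1 = b.1 then G.transfer (z * phi F ^ (a.1 : ℕ)) a.2 b.2 else 0 with hD
  -- All rows use the same lifted transfer matrix, since `(z φ ^ f) ^ F = z ^ F`.
  have key : modulation F o z * (G.timeLift F).transfer (z ^ F) = D * modulation F ι z := by
    ext ⟨f, i⟩ ⟨q', j⟩
    have hw : z * phi F ^ (f : ℕ) ≠ 0 := mul_ne_zero hz (pow_ne_zero _ (phi_ne_zero F))
    have h3 := sum_inv_pow_mul_transfer_timeLift G hw (h f)
      (by rwa [mul_phi_pow_pow hF]) q' i j
    rw [mul_phi_pow_pow hF] at h3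
    rw [Matrix.mul_apply, Matrix.mul_apply, Fintype.sum_prod_type, Fintype.sum_prod_type]
    simp only [modulation, hD, Matrix.of_apply, ite_mul, zero_mul, mul_ite, mul_zero]
    simp only [Finset.sum_ite_eq, Finset.sum_ite_eq', Finset.mem_univ, if_true]
    rw [h3, mul_comm]
  unfold freqLift
  rw [key, Matrix.mul_assoc, modulation_mul_inv hF ι hz, Matrix.mul_one]

end LTI

/-! ## Frequency responses and transients as functions of the frequency -/

theorem norm_circ (θ : ℝ) : ‖circ θ‖ = 1 := Complex.norm_exp_ofReal_mul_I θ

theorem circ_ne_zero (θ : ℝ) : circ θ ≠ 0 := Complex.exp_ne_zero _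

theorem contDiff_circ {N : WithTop ℕ∞} : ContDiff ℝ N circ := by
  unfold circ
  exact (Complex.ofRealCLM.contDiff.mul contDiff_const).cexp

theorem periodic_circ : Function.Periodic circ (2 * Real.pi) := fun θ => by
  unfold circ
  rw [Complex.ofReal_add, add_mul, Complex.exp_add]
  push_cast
  rw [Complex.exp_two_pi_mul_I, mul_one]

theorem det_circ_pow_ne_zero {s : Type*} [Fintype s] [DecidableEq s] {A : Matrix s s ℂ}
    (hA : ∀ ev ∈ spectrum ℂ A, ‖ev‖ < 1) (F : ℕ) (θ : ℝ) :
    (circ θ ^ F • (1 : Matrix s s ℂ) - A).det ≠ 0 := by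
  rw [det_smul_one_sub_ne_zero_iff]
  intro h
  have := hA _ h
  rw [norm_pow, norm_circ, one_pow] at this
  exact lt_irrefl _ this

theorem contDiff_modulation (F : ℕ) {o : Type*} [DecidableEq o] {N : WithTop ℕ∞}
    (a b : Fin F × o) : ContDiff ℝ N fun θ => modulation F o (circ θ) a b := by
  simp only [modulation, Matrix.of_apply]
  split_ifs
  · exact ((contDiff_circ.mul contDiff_const).inv fun θ =>
      mul_ne_zero (circ_ne_zero θ) (pow_ne_zero _ (phi_ne_zero F))).pow _
  · exact contDiff_const

theorem contDiff_resolvent {s : Type*} [Fintype s] [DecidableEq s] {A : Matrix s s ℂ}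
    (hA : ∀ ev ∈ spectrum ℂ A, ‖ev‖ < 1) (F : ℕ) {N : WithTop ℕ∞} (i j : s) :
    ContDiff ℝ N fun θ => (circ θ ^ F • (1 : Matrix s s ℂ) - A)⁻¹ i j := by
  refine contDiff_matrix_inv (fun i j => ?_) (fun θ => det_circ_pow_ne_zero hA F θ) i j
  simp only [Matrix.sub_apply, Matrix.smul_apply, smul_eq_mul]
  exact ((contDiff_circ.pow F).mul contDiff_const).sub contDiff_const

section Response

variable {F : ℕ} {s ι o : Type*} [Fintype s] [DecidableEq s] [Fintype o] [DecidableEq o]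

theorem contDiff_liftedFRF [Fintype ι] [DecidableEq ι] (hF : 0 < F) (G : StateSpace s (Fin F × ι) (Fin F × o))
    (hG : ∀ ev ∈ spectrum ℂ (cplx G.A), ‖ev‖ < 1) {N : WithTop ℕ∞} (a : Fin F × o)
    (b : Fin F × ι) : ContDiff ℝ N fun θ => liftedFRF F G θ a b := by
  have h1 : ∀ i j, ContDiff ℝ N fun θ => G.transfer (circ θ ^ F) i j := fun i j =>
    (contDiff_matrix_mul (A := fun θ => cplx G.C * (circ θ ^ F • (1 : Matrix s s ℂ) - cplx G.A)⁻¹)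
      (B := fun _ => cplx G.B) (contDiff_matrix_mul (A := fun _ => cplx G.C)
        (B := fun θ => (circ θ ^ F • (1 : Matrix s s ℂ) - cplx G.A)⁻¹)
        (fun _ _ => contDiff_const) (contDiff_resolvent hG F))
      (fun _ _ => contDiff_const) i j).add contDiff_const
  exact contDiff_matrix_mul (A := fun θ => modulation F o (circ θ) * G.transfer (circ θ ^ F))
    (B := fun θ => (modulation F ι (circ θ))⁻¹)
    (contDiff_matrix_mul (A := fun θ => modulation F o (circ θ))
      (B := fun θ => G.transfer (circ θ ^ F)) (contDiff_modulation F) h1)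
    (contDiff_matrix_inv (contDiff_modulation F)
      fun θ => det_modulation_ne_zero hF ι (circ_ne_zero θ)) a b

/-- The transfer `M(z) C (z ^ F I - A)⁻¹ z ^ F` from the state gap to the transient. -/
noncomputable def transientKernel (G : StateSpace s (Fin F × ι) (Fin F × o)) (θ : ℝ) :
    Matrix (Fin F × o) s ℂ :=
  modulation F o (circ θ) * (cplx G.C *
    ((circ θ ^ F • (1 : Matrix s s ℂ) - cplx G.A)⁻¹ * (circ θ ^ F • (1 : Matrix s s ℂ))))

theorem contDiff_transientKernel (G : StateSpace s (Fin F × ι) (Fin F × o))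
    (hG : ∀ ev ∈ spectrum ℂ (cplx G.A), ‖ev‖ < 1) {N : WithTop ℕ∞} (a : Fin F × o) (j : s) :
    ContDiff ℝ N fun θ => transientKernel G θ a j := by
  have h1 : ∀ i j, ContDiff ℝ N fun θ => (circ θ ^ F • (1 : Matrix s s ℂ)) i j := fun i j =>
    (contDiff_circ.pow F).mul contDiff_const
  have h2 := contDiff_matrix_mul
    (A := fun θ => (circ θ ^ F • (1 : Matrix s s ℂ) - cplx G.A)⁻¹)
    (B := fun θ => circ θ ^ F • (1 : Matrix s s ℂ)) (contDiff_resolvent hG F) h1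
  have h3 := contDiff_matrix_mul (A := fun _ => cplx G.C) (fun _ _ => contDiff_const) h2
  exact contDiff_matrix_mul (contDiff_modulation F) h3 a j

theorem transient_apply (N : ℕ) (G : StateSpace s (Fin F × ι) (Fin F × o)) (δ : s → ℝ) (θ : ℝ)
    (a : Fin F × o) : transient F N G δ θ a =
      ∑ j, (1 / (Real.sqrt N : ℂ) * δ j) * transientKernel G θ a j := by
  have : transient F N G δ θ =
      (1 / (Real.sqrt N : ℂ)) • (transientKernel G θ *ᵥ fun j => (δ j : ℂ)) := by
    unfold transient transientKernel
    simp only [← Matrix.mulVec_mulVec, Matrix.smul_mulVec, Matrix.one_mulVec]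
  rw [this, Pi.smul_apply, smul_eq_mul, Matrix.mulVec, dotProduct, Finset.mul_sum]
  exact Finset.sum_congr rfl fun j _ => by ring

theorem contDiff_transient (M : ℕ) (G : StateSpace s (Fin F × ι) (Fin F × o))
    (hG : ∀ ev ∈ spectrum ℂ (cplx G.A), ‖ev‖ < 1) (δ : s → ℝ) {N : WithTop ℕ∞}
    (a : Fin F × o) : ContDiff ℝ N fun θ => transient F M G δ θ a := by
  simp only [transient_apply]
  exact ContDiff.sum fun j _ => contDiff_const.mul (contDiff_transientKernel G hG a j)

/-- The derivative is again periodic, and it is continuous, hence bounded. This makes the constants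
uniform over all bins. -/
theorem exists_norm_iteratedDeriv_le_of_periodic {f : ℝ → ℂ} {c : ℝ} (hc : c ≠ 0) (k : ℕ)
    (hf : ContDiff ℝ k f) (hp : Function.Periodic f c) :
    ∃ C : ℝ, 0 ≤ C ∧ ∀ t, ‖iteratedDeriv k f t‖ ≤ C := by
  have hp' : Function.Periodic (iteratedDeriv k f) c := fun t => by
    rw [← congrFun (iteratedDeriv_comp_add_const k f c) t]
    exact congrArg (fun g => iteratedDeriv k g t) (funext hp)
  obtain ⟨C, hC⟩ := (hp'.isBounded_of_continuous hc
    (hf.continuous_iteratedDeriv k le_rfl)).exists_norm_le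
  exact ⟨C, (norm_nonneg _).trans (hC _ ⟨0, rfl⟩), fun t => hC _ ⟨t, rfl⟩⟩

/-- The record enters only through the constant vector `δ / √N`, which multiplies a kernel fixed by
the realization; so `C` does not depend on the experiment. -/
theorem exists_norm_iteratedDeriv_transient_le (G : StateSpace s (Fin F × ι) (Fin F × o))
    (hG : ∀ ev ∈ spectrum ℂ (cplx G.A), ‖ev‖ < 1) (k : ℕ) :
    ∃ C : ℝ, 0 ≤ C ∧ ∀ (N : ℕ) (δ : s → ℝ) (θ : ℝ) (a : Fin F × o),
      ‖iteratedDeriv k (fun θ => transient F N G δ θ a) θ‖ ≤ C * (‖δ‖ / Real.sqrt N) := by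
  have h : ∀ (a : Fin F × o) (j : s), ∃ C : ℝ, 0 ≤ C ∧
      ∀ t, ‖iteratedDeriv k (fun θ => transientKernel G θ a j) t‖ ≤ C := fun a j =>
    exists_norm_iteratedDeriv_le_of_periodic Real.two_pi_pos.ne' k
      (contDiff_transientKernel G hG a j)
      (fun θ => by simp only [transientKernel, periodic_circ θ])
  choose C hC0 hC using h
  refine ⟨∑ a, ∑ j, C a j, Finset.sum_nonneg fun a _ => Finset.sum_nonneg fun j _ => hC0 a j,
    fun N δ θ a => ?_⟩
  simp only [transient_apply]
  rw [iteratedDeriv_fun_sum fun j _ =>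
    (contDiff_const.mul (contDiff_transientKernel G hG a j)).contDiffAt]
  simp only [iteratedDeriv_const_mul_field]
  refine (norm_sum_le _ _).trans ?_
  have h1 : ∑ j, C a j ≤ ∑ a, ∑ j, C a j :=
    Finset.single_le_sum (f := fun a => ∑ j, C a j)
      (fun a _ => Finset.sum_nonneg fun j _ => hC0 a j) (Finset.mem_univ a)
  refine le_trans ?_ (mul_le_mul_of_nonneg_right h1 (by positivity))
  rw [Finset.sum_mul]
  refine Finset.sum_le_sum fun j _ => ?_
  rw [norm_mul, mul_comm (C a j)]
  refine mul_le_mul ?_ (hC a j θ) (norm_nonneg _) (by positivity)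
  rw [norm_mul, norm_div, norm_one, Complex.norm_real, Complex.norm_real, Real.norm_eq_abs,
    abs_of_nonneg (Real.sqrt_nonneg _), one_div_mul_eq_div]
  gcongr
  exact norm_le_pi_norm δ j

end Response

/-! ## The local polynomial method -/

theorem regressor_inl {R n : ℕ} {α : Type*} (U : ℤ → α → ℂ) (k : ℤ) (s : Fin (R + 1)) (a : α)
    (i : Fin (2 * n + 1)) :
    regressor R n U k (Sum.inl (s, a)) i =
      (offset n i : ℂ) ^ (s : ℕ) * U (k + offset n i) a := rfl

theorem regressor_inr {R n : ℕ} {α : Type*} (U : ℤ → α → ℂ) (k : ℤ) (s : Fin (R + 1))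
    (i : Fin (2 * n + 1)) :
    regressor R n U k (Sum.inr s) i = (offset n i : ℂ) ^ (s : ℕ) := rfl

theorem selector_inl {R : ℕ} {α : Type*} [DecidableEq α] (s : Fin (R + 1)) (a b : α) :
    selector R α (Sum.inl (s, a)) b = if (s : ℕ) = 0 ∧ a = b then 1 else 0 := rfl

theorem selector_inr {R : ℕ} {α : Type*} [DecidableEq α] (s : Fin (R + 1)) (b : α) :
    selector R α (Sum.inr s) b = 0 := rfl

section LPM

variable {R n : ℕ} {α β : Type*} [Fintype α] [DecidableEq α]

theorem lpm_add (U : ℤ → α → ℂ) (Y Y' : ℤ → β → ℂ) (k : ℤ) :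
    lpm R n U (fun m => Y m + Y' m) k = lpm R n U Y k + lpm R n U Y' k := by
  unfold lpm
  rw [← Matrix.add_mul]
  rfl

theorem lpm_apply (U : ℤ → α → ℂ) (Y : ℤ → β → ℂ) (k : ℤ) (b : β) (a : α) :
    lpm R n U Y k b a = ∑ i, Y (k + offset n i) b * lpmWeights R n U k i a := rfl

/-- On data that follow a local polynomial model, LPM returns the constant coefficient. -/
theorem lpm_eq_of_polynomial {U : ℤ → α → ℂ} {k : ℤ} (h : Exciting R n U k) (Y : ℤ → β → ℂ)
    (Θ : ℕ → Matrix β α ℂ) (τ : ℕ → β → ℂ)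
    (hY : ∀ i, Y (k + offset n i) = ∑ s ∈ Finset.range (R + 1),
      (offset n i : ℂ) ^ s • (Θ s *ᵥ U (k + offset n i) + τ s)) :
    lpm R n U Y k = Θ 0 := by
  -- With the coefficients gathered in one matrix `Θ'`, the data are `Θ' K_n`; the least-squares
  -- weights then cancel `K_n` and leave `Θ'` times the selector.
  set Θ' : Matrix β ((Fin (R + 1) × α) ⊕ Fin (R + 1)) ℂ := Matrix.of fun b row =>
    Sum.elim (fun a : Fin (R + 1) × α => Θ a.1 b a.2) (fun s : Fin (R + 1) => τ s b) row with hΘ'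
  have h1 : (Matrix.of fun b i => Y (k + offset n i) b : Matrix β (Fin (2 * n + 1)) ℂ) =
      Θ' * regressor R n U k := by
    ext b i
    rw [Matrix.of_apply, hY, Matrix.mul_apply, Fintype.sum_sum_type, Fintype.sum_prod_type,
      Finset.sum_range, Finset.sum_apply]
    simp only [hΘ', regressor_inl, regressor_inr, Matrix.of_apply, Sum.elim_inl, Sum.elim_inr]
    rw [← Finset.sum_add_distrib]
    refine Finset.sum_congr rfl fun s _ => ?_
    simp only [Pi.smul_apply, Pi.add_apply, smul_eq_mul, Matrix.mulVec, dotProduct, mul_add,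
      Finset.mul_sum]
    congr 1
    · exact Finset.sum_congr rfl fun a _ => by ring
    · ring
  have h2 : Θ' * selector R α = Θ 0 := by
    ext b a
    rw [Matrix.mul_apply, Fintype.sum_sum_type, Fintype.sum_prod_type]
    simp only [selector_inr, mul_zero, Finset.sum_const_zero, add_zero]
    rw [Finset.sum_eq_single_of_mem (0 : Fin (R + 1)) (Finset.mem_univ _)]
    · simp [hΘ', selector_inl]
    · intro s _ hs
      have : (s : ℕ) ≠ 0 := fun h => hs (Fin.ext h)
      simp [selector_inl, this]
  unfold lpm lpmWeights
  rw [h1, Matrix.mul_assoc, ← Matrix.mul_assoc (regressor R n U k),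
    ← Matrix.mul_assoc (regressor R n U k), Matrix.mul_nonsing_inv _ h, Matrix.one_mul, h2]

theorem binFreq_add (N : ℕ) (k m : ℤ) : binFreq N k + binFreq N m = binFreq N (k + m) := by
  unfold binFreq
  push_cast
  ring

/-- Without noise, the error of LPM consists of interpolation and leakage error. -/
theorem lpm_eq_add_errors {U : ℤ → α → ℂ} {k : ℤ} (h : Exciting R n U k) (N : ℕ) (Y : ℤ → β → ℂ)
    (G : ℝ → Matrix β α ℂ) (T : ℝ → β → ℂ)
    (hY : ∀ m, Y m = G (binFreq N m) *ᵥ U m + T (binFreq N m)) :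
    lpm R n U Y k =
      G (binFreq N k) + (interpError R n N U G k + leakError R n N U T k) := by
  set Y₁ : ℤ → β → ℂ := fun m => (Matrix.of fun b a =>
    taylorRem R (fun θ => G θ b a) (binFreq N k) (binFreq N (m - k))) *ᵥ U m with hY₁
  set Y₂ : ℤ → β → ℂ := fun m b =>
    taylorRem R (fun θ => T θ b) (binFreq N k) (binFreq N (m - k)) with hY₂
  have h1 : lpm R n U (fun m => Y m - (Y₁ m + Y₂ m)) k = G (binFreq N k) := by
    -- LPM polynomials are in the offset counted in bins, so the Taylor coefficient of order `s` in
    -- the frequency is rescaled by `(2π/N) ^ s`.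
    rw [lpm_eq_of_polynomial h (fun m => Y m - (Y₁ m + Y₂ m))
      (fun s => Matrix.of fun b a => iteratedDeriv s (fun θ => G θ b a) (binFreq N k) /
        (s.factorial : ℂ) * (2 * Real.pi / N : ℂ) ^ s)
      (fun s b => iteratedDeriv s (fun θ => T θ b) (binFreq N k) /
        (s.factorial : ℂ) * (2 * Real.pi / N : ℂ) ^ s)]
    · ext b a
      simp
    · intro i
      ext b
      have hb : binFreq N k + binFreq N (k + offset n i - k) = binFreq N (k + offset n i) := by
        rw [binFreq_add]; congr 1; ring
      have hb' : ((binFreq N (k + offset n i - k) : ℝ) : ℂ) =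
          (2 * Real.pi / N : ℂ) * (offset n i : ℂ) := by
        unfold binFreq
        push_cast
        ring
      simp only [hY, hY₁, hY₂, Pi.sub_apply, Pi.add_apply, Finset.sum_apply, Pi.smul_apply,
        smul_eq_mul, Matrix.mulVec, dotProduct, Matrix.of_apply, taylorRem, hb, hb', mul_add,
        Finset.sum_add_distrib, sub_mul, Finset.sum_sub_distrib, mul_pow]
      simp only [Finset.mul_sum, Finset.sum_mul]
      rw [Finset.sum_comm, add_sub_add_comm, sub_sub_cancel, sub_sub_cancel]
      congr 1
      · exact Finset.sum_congr rfl fun s _ => Finset.sum_congr rfl fun a _ => by ring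
      · exact Finset.sum_congr rfl fun s _ => by ring
  have h2 : lpm R n U Y k = lpm R n U (fun m => (Y m - (Y₁ m + Y₂ m)) + (Y₁ m + Y₂ m)) k := by
    simp
  rw [h2, lpm_add, h1, lpm_add]
  rfl

variable [Fintype β]

/-- Source of both gains: `y i` bounds every output component at once, so each row sum of the
estimate has the same bound. -/
theorem norm_lpm_le (U : ℤ → α → ℂ) (Y : ℤ → β → ℂ) (k : ℤ) (y : Fin (2 * n + 1) → ℝ)
    (hy : ∀ i, 0 ≤ y i) (hY : ∀ i b, ‖Y (k + offset n i) b‖ ≤ y i) :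
    ‖lpm R n U Y k‖ ≤ ∑ i, y i * ∑ a, ‖lpmWeights R n U k i a‖ := by
  refine norm_le_of_sum_norm_row_le _ (Finset.sum_nonneg fun i _ =>
    mul_nonneg (hy i) (Finset.sum_nonneg fun _ _ => norm_nonneg _)) fun b => ?_
  calc ∑ a, ‖lpm R n U Y k b a‖
      ≤ ∑ a, ∑ i, y i * ‖lpmWeights R n U k i a‖ := by
        refine Finset.sum_le_sum fun a _ => ?_
        rw [lpm_apply]
        refine (norm_sum_le _ _).trans (Finset.sum_le_sum fun i _ => ?_)
        rw [norm_mul]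
        exact mul_le_mul_of_nonneg_right (hY i b) (norm_nonneg _)
    _ = ∑ i, y i * ∑ a, ‖lpmWeights R n U k i a‖ := by
        rw [Finset.sum_comm]
        simp only [Finset.mul_sum]

theorem abs_offset_le (n : ℕ) (i : Fin (2 * n + 1)) : |(offset n i : ℝ)| ≤ n := by
  have h := i.2
  have : |offset n i| ≤ (n : ℤ) := by
    unfold offset
    rw [abs_le]
    omega
  exact_mod_cast this

theorem abs_binFreq_offset_le (N : ℕ) (k : ℤ) (i : Fin (2 * n + 1)) :
    |binFreq N (k + offset n i - k)| ≤ 2 * Real.pi * (n / N) := by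
  have h : binFreq N (k + offset n i - k) = 2 * Real.pi * ((offset n i : ℝ) / N) := by
    unfold binFreq
    push_cast
    ring
  rw [h, abs_mul, abs_of_pos Real.two_pi_pos, abs_div, Nat.abs_cast]
  gcongr
  exact abs_offset_le n i

/-- Every offset is at most `2πn/N` in frequency, which gives the power of `2π`. The number of
inputs appears because each remainder entry is bounded by the full norm and multiplied by the
maximum norm of the input. -/
theorem norm_interpError_le (N : ℕ) (U : ℤ → α → ℂ) (G : ℝ → Matrix β α ℂ) (k : ℤ)
    (hG : ∀ b a, ContDiff ℝ (R + 1) fun θ => G θ b a) (B : ℝ)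
    (hB : ∀ θ ∈ Set.Icc (binFreq N (k - n)) (binFreq N (k + n)), ‖matDeriv (R + 1) G θ‖ ≤ B) :
    ‖interpError R n N U G k‖ ≤ (Fintype.card α * (2 * Real.pi) ^ (R + 1)) *
      interpGain R n U k * B * ((n : ℝ) / N) ^ (R + 1) := by
  -- The window is exactly the interval of radius `2πn/N` about the centre, so the assumed
  -- derivative bound applies wherever the Taylor estimate needs it.
  have hcent : ∀ t : ℝ, |t| ≤ 2 * Real.pi * (n / N) → binFreq N k + t ∈
      Set.Icc (binFreq N (k - n)) (binFreq N (k + n)) := fun t ht => by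
    obtain ⟨h1, h2⟩ := abs_le.1 ht
    have e1 : binFreq N (k - n) = binFreq N k - 2 * Real.pi * (n / N) := by
      unfold binFreq; push_cast; ring
    have e2 : binFreq N (k + n) = binFreq N k + 2 * Real.pi * (n / N) := by
      unfold binFreq; push_cast; ring
    rw [e1, e2]
    constructor <;> linarith
  have hB0 : 0 ≤ B := (norm_nonneg _).trans
    (hB _ (hcent 0 (by rw [abs_zero]; positivity)))
  refine (norm_lpm_le U _ k
    (fun i => Fintype.card α * (B * (2 * Real.pi * (n / N)) ^ (R + 1)) * ‖U (k + offset n i)‖)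
    (fun i => by positivity) fun i b => ?_).trans_eq ?_
  · rw [Matrix.mulVec, dotProduct]
    refine (norm_sum_le _ _).trans ?_
    have h1 : ∀ a ∈ Finset.univ, ‖(Matrix.of fun b a => taylorRem R (fun θ => G θ b a)
        (binFreq N k) (binFreq N (k + offset n i - k)) : Matrix β α ℂ) b a * U (k + offset n i) a‖
        ≤ B * (2 * Real.pi * (n / N)) ^ (R + 1) * ‖U (k + offset n i)‖ := fun a _ => by
      rw [norm_mul, Matrix.of_apply]
      have h2 := norm_taylorRem_le R (hG b a) (c := binFreq N k) (b := B)
        (fun t ht => (norm_entry_le (matDeriv (R + 1) G (binFreq N k + t)) b a).trans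
          (hB _ (hcent t ht))) (abs_binFreq_offset_le N k i)
      have h3 := abs_binFreq_offset_le N k i
      refine mul_le_mul (h2.trans ?_) (norm_le_pi_norm _ a) (norm_nonneg _) (by positivity)
      gcongr
    refine (Finset.sum_le_card_nsmul _ _ _ h1).trans_eq ?_
    rw [nsmul_eq_mul, Finset.card_univ]
    ring
  · rw [interpGain, mul_pow, Finset.mul_sum, Finset.sum_mul, Finset.sum_mul]
    exact Finset.sum_congr rfl fun i _ => by ring

theorem norm_leakError_le (N : ℕ) (U : ℤ → α → ℂ) (T : ℝ → β → ℂ) (k : ℤ)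
    (hT : ∀ b, ContDiff ℝ (R + 1) fun θ => T θ b) {B : ℝ} (hB0 : 0 ≤ B)
    (hB : ∀ θ b, ‖iteratedDeriv (R + 1) (fun θ => T θ b) θ‖ ≤ B) :
    ‖leakError R n N U T k‖ ≤ (2 * Real.pi) ^ (R + 1) *
      (leakGain R n U k * B) * ((n : ℝ) / N) ^ (R + 1) := by
  refine (norm_lpm_le U _ k (fun _ => B * (2 * Real.pi * (n / N)) ^ (R + 1))
    (fun i => by positivity) fun i b => ?_).trans_eq ?_
  · have h2 := norm_taylorRem_le R (hT b) (c := binFreq N k) (b := B)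
        (fun t _ => hB _ b) (abs_binFreq_offset_le N k i)
    have h3 := abs_binFreq_offset_le N k i
    refine h2.trans ?_
    gcongr
  · rw [leakGain, mul_pow, ← Finset.mul_sum]
    ring

end LPM

/-! ## Time lifting of signals -/

/-- The time-lifted signal: the samples of period `l`. -/
def liftSignal (F : ℕ) {ι β : Type*} (v : ℕ → ι → β) (l : ℕ) : Fin F × ι → β :=
  fun a => v (l * F + a.1) a.2

section TimeLift

variable {σ ι o : Type*} [Fintype σ] [DecidableEq σ] [Fintype ι]

/-- Variation of constants. Taking `q = F` gives the lifted state equation, `q < F` the outputs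
inside a period. -/
theorem state_add {A : Matrix σ σ ℝ} {B : Matrix σ ι ℝ} {x : ℕ → σ → ℝ} {u : ℕ → ι → ℝ}
    (hx : ∀ t, x (t + 1) = A *ᵥ x t + B *ᵥ u t) (t q : ℕ) :
    x (t + q) = A ^ q *ᵥ x t +
      ∑ j ∈ Finset.range q, (A ^ (q - 1 - j) * B) *ᵥ u (t + j) := by
  induction q with
  | zero => simp
  | succ q ih =>
    rw [← add_assoc, hx, ih, Matrix.mulVec_add, Matrix.mulVec_mulVec, ← pow_succ',
      Finset.sum_range_succ, ← Matrix.mulVecLin_apply A, map_sum]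
    simp only [Matrix.mulVecLin_apply, Matrix.mulVec_mulVec, add_assoc, ← Matrix.mul_assoc,
      ← pow_succ']
    congr 2
    · refine Finset.sum_congr rfl fun j hj => ?_
      have := Finset.mem_range.1 hj
      rw [show q - 1 - j + 1 = q + 1 - 1 - j by omega]
    · simp

theorem timeLift_state (F : ℕ) (G : StateSpace σ ι o) {x : ℕ → σ → ℝ} {u : ℕ → ι → ℝ}
    (hx : ∀ t, x (t + 1) = G.A *ᵥ x t + G.B *ᵥ u t) (l : ℕ) :
    x ((l + 1) * F) =
      (G.timeLift F).A *ᵥ x (l * F) + (G.timeLift F).B *ᵥ liftSignal F u l := by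
  rw [add_mul, one_mul, state_add hx]
  congr 1
  ext s
  rw [Finset.sum_apply, Finset.sum_range, Matrix.mulVec, dotProduct, Fintype.sum_prod_type]
  rfl

theorem timeLift_output (F : ℕ) (G : StateSpace σ ι o) {x : ℕ → σ → ℝ} {u : ℕ → ι → ℝ}
    {y : ℕ → o → ℝ} (hx : ∀ t, x (t + 1) = G.A *ᵥ x t + G.B *ᵥ u t)
    (hy : ∀ t, y t = G.C *ᵥ x t + G.D *ᵥ u t) (l : ℕ) :
    liftSignal F y l =
      (G.timeLift F).C *ᵥ x (l * F) + (G.timeLift F).D *ᵥ liftSignal F u l := by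
  ext ⟨⟨q, hq⟩, i⟩
  -- Inputs before sample `q` act through the state, the input at `q` through `D`, and the `n` later
  -- ones not at all.
  obtain ⟨n, rfl⟩ : ∃ n, F = q + 1 + n := ⟨F - (q + 1), by omega⟩
  have h1 : ((G.timeLift (q + 1 + n)).D *ᵥ liftSignal (q + 1 + n) u l) (⟨q, hq⟩, i) =
      ∑ j ∈ Finset.range (q + 1 + n), ((if j < q then G.C * G.A ^ (q - j - 1) * G.B
        else if j = q then G.D else 0) *ᵥ u (l * (q + 1 + n) + j)) i := by
    rw [Matrix.mulVec, dotProduct, Fintype.sum_prod_type, Finset.sum_range]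
    refine Finset.sum_congr rfl fun b _ => Finset.sum_congr rfl fun c _ => ?_
    simp only [StateSpace.timeLift, Matrix.of_apply, liftSignal, Fin.ext_iff]
    split_ifs <;> rfl
  rw [Pi.add_apply, h1, Finset.sum_range_add, Finset.sum_range_succ,
    Finset.sum_eq_zero (s := Finset.range n), add_zero]
  · simp only [liftSignal]
    rw [hy, state_add hx, Matrix.mulVec_add, Matrix.mulVec_mulVec, Pi.add_apply, Pi.add_apply,
      ← Matrix.mulVecLin_apply G.C, map_sum, Finset.sum_apply, add_assoc]
    refine congrArg₂ (· + ·) rfl (congrArg₂ (· + ·) ?_ ?_)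
    · refine Finset.sum_congr rfl fun j hj => ?_
      have := Finset.mem_range.1 hj
      rw [if_pos this, Matrix.mulVecLin_apply, Matrix.mulVec_mulVec, ← Matrix.mul_assoc,
        show q - 1 - j = q - j - 1 by omega]
    · simp
  · intro j _
    rw [if_neg (by omega), if_neg (by omega), Matrix.zero_mulVec, Pi.zero_apply]

end TimeLift

/-! ## The loop in the time domain -/

section Loop

variable {σ κ a b : Type*} [Fintype σ] [Fintype κ] [Fintype a] [DecidableEq a] [Fintype b]

/-- Eliminating `y` leaves a linear equation for `u` with matrix `1 + Q.D * G.D`; well-posedness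
solves it and the rest is substitution. No time index occurs, so one step may be a whole period. -/
theorem loop_equations (G : StateSpace σ a b) (Q : StateSpace κ b a)
    (hwell : IsUnit (1 + Q.D * G.D).det) {x x' : σ → ℝ} {xQ xQ' : κ → ℝ} {r u : a → ℝ}
    {y : b → ℝ} (hx : x' = G.A *ᵥ x + G.B *ᵥ u) (hy : y = G.C *ᵥ x + G.D *ᵥ u)
    (hxQ : xQ' = Q.A *ᵥ xQ + Q.B *ᵥ y) (hu : u = r - (Q.C *ᵥ xQ + Q.D *ᵥ y)) :
    Sum.elim x' xQ' =
      (sensitivity G Q).A *ᵥ Sum.elim x xQ + (sensitivity G Q).B *ᵥ r ∧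
    u = (sensitivity G Q).C *ᵥ Sum.elim x xQ + (sensitivity G Q).D *ᵥ r ∧
    y = (processSensitivity G Q).C *ᵥ Sum.elim x xQ + (processSensitivity G Q).D *ᵥ r := by
  have h1 : (1 + Q.D * G.D) *ᵥ u = r - Q.C *ᵥ xQ - (Q.D * G.C) *ᵥ x := by
    rw [Matrix.add_mulVec, Matrix.one_mulVec]
    nth_rewrite 1 [hu]
    rw [hy, Matrix.mulVec_add, Matrix.mulVec_mulVec, Matrix.mulVec_mulVec]
    abel
  have h2 : u = loopGain G Q *ᵥ (r - Q.C *ᵥ xQ - (Q.D * G.C) *ᵥ x) := by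
    rw [← h1, Matrix.mulVec_mulVec, loopGain, Matrix.nonsing_inv_mul _ hwell, Matrix.one_mulVec]
  have h3 : u = (sensitivity G Q).C *ᵥ Sum.elim x xQ + (sensitivity G Q).D *ᵥ r := by
    rw [h2]
    simp only [sensitivity, Matrix.fromCols_mulVec_sumElim, Matrix.mulVec_sub, Matrix.neg_mulVec,
      Matrix.mulVec_mulVec, Matrix.mul_assoc]
    abel
  have h4 : y = (processSensitivity G Q).C *ᵥ Sum.elim x xQ +
      (processSensitivity G Q).D *ᵥ r := by
    rw [hy, h2]
    simp only [processSensitivity, Matrix.fromCols_mulVec_sumElim, Matrix.mulVec_sub,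
      Matrix.neg_mulVec, Matrix.sub_mulVec, Matrix.mulVec_mulVec, Matrix.mul_assoc]
    abel
  refine ⟨?_, h3, h4⟩
  rw [hx, hxQ, hy, h2]
  simp only [sensitivity, Matrix.fromBlocks_mulVec, Matrix.fromRows_mulVec, Matrix.mulVec_sub,
    Matrix.neg_mulVec, Matrix.sub_mulVec, Matrix.mulVec_mulVec, Matrix.mul_assoc,
    Matrix.mulVec_add, Matrix.mul_sub, Sum.elim_comp_inl, Sum.elim_comp_inr]
  ext (i | i)
  · simp only [Sum.elim_inl, Pi.add_apply, Pi.sub_apply, Pi.neg_apply]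
    ring
  · simp only [Sum.elim_inr, Pi.add_apply, Pi.sub_apply]
    ring

end Loop

theorem downsampler_mulVec_liftSignal {F : ℕ} (hF : 0 < F) {υ : Type*} [Fintype υ]
    [DecidableEq υ] (y : ℕ → υ → ℝ) (l : ℕ) :
    downsampler F υ *ᵥ liftSignal F y l = y (l * F) := by
  ext i
  rw [Matrix.mulVec, dotProduct, Fintype.sum_prod_type,
    Finset.sum_eq_single_of_mem (⟨0, hF⟩ : Fin F) (Finset.mem_univ _)]
  · simp [downsampler, liftSignal]
  · intro q _ hq
    have : (q : ℕ) ≠ 0 := fun h => hq (Fin.ext h)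
    simp [downsampler, this]

theorem zeroOrderHold_mulVec (F : ℕ) {μ : Type*} [Fintype μ] [DecidableEq μ] (w : μ → ℝ)
    (a : Fin F × μ) : (zeroOrderHold F μ *ᵥ w) a = w a.2 := by
  simp [zeroOrderHold, Matrix.mulVec, dotProduct]

section Multirate

variable {σ κ μ υ : Type*} [Fintype σ] [DecidableEq σ]
  [Fintype μ] [DecidableEq μ] [Fintype υ] [DecidableEq υ]

theorem downsampler_mul_timeLift_mul_hold {F : ℕ} (hF : 0 < F) (P : StateSpace σ μ υ) :
    downsampler F υ * (P.timeLift F).D * zeroOrderHold F μ = P.D := by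
  ext i j
  have h1 : ∀ b, (downsampler F υ * (P.timeLift F).D) i b =
      (P.timeLift F).D (⟨0, hF⟩, i) b := fun b => by
    rw [Matrix.mul_apply, Fintype.sum_prod_type,
      Finset.sum_eq_single_of_mem (⟨0, hF⟩ : Fin F) (Finset.mem_univ _)]
    · simp [downsampler]
    · intro q _ hq
      have : (q : ℕ) ≠ 0 := fun h => hq (Fin.ext h)
      simp [downsampler, this]
  rw [Matrix.mul_apply, Fintype.sum_prod_type,
    Finset.sum_eq_single_of_mem (⟨0, hF⟩ : Fin F) (Finset.mem_univ _)]
  · simp_rw [h1]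
    simp [zeroOrderHold, StateSpace.timeLift]
  · intro q _ hq
    simp_rw [h1]
    have h0 : ¬ q < ⟨0, hF⟩ := fun h => absurd (Fin.lt_def.1 h) (Nat.not_lt_zero _)
    simp [StateSpace.timeLift, hq, h0]

/-- The identity `det (1 + X Y) = det (1 + Y X)` moves the hold next to the downsampler. Between
them only the instantaneous effect of the first input sample on the first output sample survives,
namely `P.D`. -/
theorem isUnit_det_lifted_loop {F : ℕ} (hF : 0 < F) (P : StateSpace σ μ υ)
    (K : StateSpace κ υ μ) (hwell : IsUnit (1 + K.D * P.D).det) :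
    IsUnit (1 + (heldController F K).D * (P.timeLift F).D).det := by
  have h : (1 + (heldController F K).D * (P.timeLift F).D).det = (1 + K.D * P.D).det := by
    have h1 : (heldController F K).D * (P.timeLift F).D =
        zeroOrderHold F μ * (K.D * (downsampler F υ * (P.timeLift F).D)) := by
      simp only [heldController, Matrix.mul_assoc]
    rw [h1, Matrix.det_one_add_mul_comm, Matrix.mul_assoc,
      downsampler_mul_timeLift_mul_hold hF]
  rwa [h]

variable [Fintype κ] {Ω : Type*} [MeasurableSpace Ω] {ℙ : Measure Ω}

theorem Experiment.lifted_equations {F : ℕ} (hF : 0 < F) {P : StateSpace σ μ υ}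
    {K : StateSpace κ υ μ} (hwell : IsUnit (1 + K.D * P.D).det) (E : Experiment F P K ℙ) (l : ℕ) :
    Sum.elim (E.x ((l + 1) * F)) (E.xK (l + 1)) =
      (liftedS F P K).A *ᵥ Sum.elim (E.x (l * F)) (E.xK l) +
        (liftedS F P K).B *ᵥ liftSignal F E.r l ∧
    liftSignal F E.u l = (liftedS F P K).C *ᵥ Sum.elim (E.x (l * F)) (E.xK l) +
        (liftedS F P K).D *ᵥ liftSignal F E.r l ∧
    liftSignal F E.y l = (liftedJ F P K).C *ᵥ Sum.elim (E.x (l * F)) (E.xK l) +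
        (liftedJ F P K).D *ᵥ liftSignal F E.r l := by
  refine loop_equations _ _ (isUnit_det_lifted_loop hF P K hwell)
    (timeLift_state F P E.x_succ l) (timeLift_output F P E.x_succ E.y_eq l) ?_ ?_
  · rw [E.xK_succ]
    simp only [heldController]
    rw [← Matrix.mulVec_mulVec, downsampler_mulVec_liftSignal hF]
  · simp only [heldController]
    rw [← Matrix.mulVec_mulVec, ← Matrix.mulVec_mulVec, ← Matrix.mulVec_mulVec,
      downsampler_mulVec_liftSignal hF, ← Matrix.mulVec_add, ← E.w_eq]
    ext ⟨q, i⟩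
    rw [Pi.sub_apply, zeroOrderHold_mulVec]
    simp only [liftSignal]
    -- Throughout period `l` the floor of `t / F` is `l`: this is the zero-order hold.
    rw [E.u_eq, Pi.sub_apply, mul_comm l F, Nat.mul_add_div hF, Nat.div_eq_of_lt q.2, add_zero]

end Multirate

/-! ## The loop in the frequency domain -/

theorem circ_pow (θ : ℝ) (n : ℕ) : circ θ ^ n = circ (n * θ) := by
  unfold circ
  rw [← Complex.exp_nat_mul]
  push_cast
  ring_nf

theorem circ_binFreq_pow {N : ℕ} (hN : 0 < N) (k : ℤ) : circ (binFreq N k) ^ N = 1 := by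
  have hN' : (N : ℝ) ≠ 0 := by positivity
  rw [circ_pow]
  unfold binFreq
  rw [mul_div_cancel₀ _ hN']
  unfold circ
  rw [Complex.exp_eq_one_iff]
  exact ⟨k, by push_cast; ring⟩

theorem circ_binFreq_mul_phi_pow {F L : ℕ} (hF : 0 < F) (hL : 0 < L) (k : ℤ) (f : ℕ) :
    circ (binFreq (F * L) k) * phi F ^ f = circ (binFreq (F * L) (k + f * L)) := by
  have hF' : (F : ℂ) ≠ 0 := by exact_mod_cast hF.ne'
  have hL' : (L : ℂ) ≠ 0 := by exact_mod_cast hL.ne'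
  unfold circ phi binFreq
  rw [← Complex.exp_nat_mul, ← Complex.exp_add]
  congr 1
  push_cast
  field_simp

theorem sum_range_mul {M : Type*} [AddCommMonoid M] (F L : ℕ) (f : ℕ → M) :
    ∑ t ∈ Finset.range (F * L), f t =
      ∑ l ∈ Finset.range L, ∑ q ∈ Finset.range F, f (l * F + q) := by
  induction L with
  | zero => simp
  | succ L ih => rw [mul_add, mul_one, Finset.sum_range_add, ih, Finset.sum_range_succ,
      mul_comm F L]

/-- The truncated z-transform of a time-lifted record. -/
noncomputable def zSum (L : ℕ) (ζ : ℂ) {s : Type*} (v : ℕ → s → ℂ) : s → ℂ :=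
  ∑ l ∈ Finset.range L, (ζ⁻¹) ^ l • v l

theorem mulVec_zSum {s t : Type*} [Fintype s] (A : Matrix t s ℂ) (L : ℕ) (ζ : ℂ)
    (v : ℕ → s → ℂ) : A *ᵥ zSum L ζ v = zSum L ζ fun l => A *ᵥ v l := by
  unfold zSum
  rw [← Matrix.mulVecLin_apply, map_sum]
  simp only [map_smul, Matrix.mulVecLin_apply]

theorem zSum_add {s : Type*} (L : ℕ) (ζ : ℂ) (v w : ℕ → s → ℂ) :
    zSum L ζ (fun l => v l + w l) = zSum L ζ v + zSum L ζ w := by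
  simp only [zSum, smul_add, Finset.sum_add_distrib]

/-- Since `ζ ^ L = 1`, the samples dropped and gained by the shift carry the same weight and combine
into `v 0 - v L`. This is the only origin of leakage. -/
theorem zSum_shift {s : Type*} {L : ℕ} {ζ : ℂ} (hζ : ζ ≠ 0) (hL : ζ ^ L = 1)
    (v : ℕ → s → ℂ) :
    zSum L ζ (fun l => v (l + 1)) = ζ • zSum L ζ v - ζ • (v 0 - v L) := by
  have h1 : zSum L ζ (fun l => v (l + 1)) =
      ζ • ∑ l ∈ Finset.range L, (ζ⁻¹) ^ (l + 1) • v (l + 1) := by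
    unfold zSum
    rw [Finset.smul_sum]
    refine Finset.sum_congr rfl fun l _ => ?_
    rw [smul_smul, pow_succ', mul_inv_cancel_left₀ hζ]
  have h2 := Finset.sum_range_succ' (fun l => (ζ⁻¹) ^ l • v l) L
  rw [Finset.sum_range_succ, inv_pow ζ L, hL, inv_one, one_smul, pow_zero, one_smul] at h2
  rw [h1, ← smul_sub]
  congr 1
  unfold zSum
  rw [sub_sub_eq_add_sub, h2, add_sub_cancel_right]

/-- For `t = lF + q` the Fourier kernel factors as `(z ^ F) ^ (-l)` times `(z φ ^ f) ^ (-q)`: the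
first factor is free of `f`, the second is the entry of `M(z)`. -/
theorem liftedDFT_eq {F L : ℕ} (hF : 0 < F) (hL : 0 < L) {ι : Type*} [Fintype ι] [DecidableEq ι]
    (v : ℕ → ι → ℝ) (k : ℤ) :
    liftedDFT F L v k = (1 / (Real.sqrt (F * L : ℕ) : ℂ)) •
      (modulation F ι (circ (binFreq (F * L) k)) *ᵥ
        zSum L (circ (binFreq (F * L) k) ^ F)
          (liftSignal F fun t i => (v t i : ℂ))) := by
  ext ⟨f, i⟩
  set z := circ (binFreq (F * L) k) with hz
  rw [Pi.smul_apply, smul_eq_mul]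
  unfold liftedDFT dft
  congr 1
  rw [sum_range_mul, mulVec_zSum]
  unfold zSum
  rw [Finset.sum_apply]
  refine Finset.sum_congr rfl fun l _ => ?_
  simp only [Pi.smul_apply, smul_eq_mul, Matrix.mulVec, dotProduct]
  rw [Fintype.sum_prod_type, Finset.sum_range, Finset.mul_sum]
  refine Finset.sum_congr rfl fun q _ => ?_
  simp only [modulation, Matrix.of_apply, ite_mul, zero_mul, Finset.sum_ite_eq,
    Finset.mem_univ, if_true, liftSignal]
  have h1 : Complex.exp (-(2 * Real.pi * Complex.I * ((l * F + (q : ℕ) : ℕ) : ℂ) *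
      ((k + (f : ℕ) * L : ℤ) : ℂ) / ((F * L : ℕ) : ℂ))) =
      ((z * phi F ^ (f : ℕ))⁻¹) ^ (l * F + (q : ℕ)) := by
    rw [hz, circ_binFreq_mul_phi_pow hF hL, inv_pow, circ_pow, Complex.exp_neg]
    unfold circ binFreq
    congr 2
    push_cast
    ring
  rw [h1, pow_add, mul_comm l F, pow_mul, inv_pow _ F, mul_phi_pow_pow hF]
  ring

theorem cplx_mulVec_add {m n p : Type*} [Fintype m] [Fintype n] (A : Matrix p m ℝ)
    (B : Matrix p n ℝ) (v : m → ℝ) (w : n → ℝ) :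
    (fun i => ((A *ᵥ v + B *ᵥ w) i : ℂ)) =
      cplx A *ᵥ (fun i => (v i : ℂ)) + cplx B *ᵥ fun i => (w i : ℂ) := by
  rw [← cplx_mulVec, ← cplx_mulVec]
  ext i
  simp

theorem liftedDFT_response {F L : ℕ} (hF : 0 < F) (hL : 0 < L) {s ι o : Type*} [Fintype s]
    [DecidableEq s] [Fintype ι] [DecidableEq ι] [Fintype o] [DecidableEq o]
    (G : StateSpace s (Fin F × ι) (Fin F × o))
    (hG : ∀ ev ∈ spectrum ℂ (cplx G.A), ‖ev‖ < 1) {ξ : ℕ → s → ℝ} {v : ℕ → ι → ℝ}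
    {y : ℕ → o → ℝ} (hξ : ∀ l, ξ (l + 1) = G.A *ᵥ ξ l + G.B *ᵥ liftSignal F v l)
    (hy : ∀ l, liftSignal F y l = G.C *ᵥ ξ l + G.D *ᵥ liftSignal F v l) (k : ℤ) :
    liftedDFT F L y k =
      liftedFRF F G (binFreq (F * L) k) *ᵥ liftedDFT F L v k +
        transient F (F * L) G (ξ 0 - ξ L) (binFreq (F * L) k) := by
  set z := circ (binFreq (F * L) k) with hz
  have hz0 : z ≠ 0 := circ_ne_zero _
  set ζ := z ^ F with hζ
  have hζ0 : ζ ≠ 0 := pow_ne_zero _ hz0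
  have hζL : ζ ^ L = 1 := by
    rw [hζ, ← pow_mul, hz, circ_binFreq_pow (Nat.mul_pos hF hL)]
  set V := zSum L ζ (liftSignal F fun t i => (v t i : ℂ)) with hV
  set Y := zSum L ζ (liftSignal F fun t i => (y t i : ℂ)) with hY
  set Ξ := zSum L ζ (fun l i => (ξ l i : ℂ)) with hΞ
  set δ : s → ℂ := fun i => ((ξ 0 - ξ L) i : ℂ) with hδ
  -- The transformed state equation; no approximation is involved, because the wrap-around is
  -- recorded by `δ`.
  have e1 : ζ • Ξ - ζ • δ = cplx G.A *ᵥ Ξ + cplx G.B *ᵥ V := by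
    have h1 := zSum_shift hζ0 hζL (fun l i => (ξ l i : ℂ))
    have h2 : zSum L ζ (fun l i => (ξ (l + 1) i : ℂ)) = cplx G.A *ᵥ Ξ + cplx G.B *ᵥ V := by
      rw [hΞ, hV, mulVec_zSum, mulVec_zSum, ← zSum_add]
      congr 1
      ext1 l
      rw [hξ l]
      exact cplx_mulVec_add _ _ _ _
    rw [← h2, h1]
    congr 2
    ext i
    simp [hδ]
  have e2 : Y = cplx G.C *ᵥ Ξ + cplx G.D *ᵥ V := by
    rw [hY, hΞ, hV, mulVec_zSum, mulVec_zSum, ← zSum_add]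
    congr 1
    ext1 l
    refine Eq.trans ?_ (cplx_mulVec_add G.C G.D (ξ l) (liftSignal F v l))
    rw [← hy l]
    rfl
  have hdet : (ζ • (1 : Matrix s s ℂ) - cplx G.A).det ≠ 0 := det_circ_pow_ne_zero hG F _
  have e3 : Ξ = (ζ • (1 : Matrix s s ℂ) - cplx G.A)⁻¹ *ᵥ (cplx G.B *ᵥ V + ζ • δ) := by
    have h1 : (ζ • (1 : Matrix s s ℂ) - cplx G.A) *ᵥ Ξ = cplx G.B *ᵥ V + ζ • δ := by
      rw [Matrix.sub_mulVec, Matrix.smul_mulVec, Matrix.one_mulVec, sub_eq_iff_eq_add, add_assoc,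
        add_comm (ζ • δ), ← add_assoc, add_comm (cplx G.B *ᵥ V), ← e1, sub_add_cancel]
    rw [← h1, Matrix.mulVec_mulVec, Matrix.nonsing_inv_mul _ (isUnit_iff_ne_zero.2 hdet),
      Matrix.one_mulVec]
  have e4 : Y = G.transfer ζ *ᵥ V + cplx G.C *ᵥ
      ((ζ • (1 : Matrix s s ℂ) - cplx G.A)⁻¹ *ᵥ (ζ • δ)) := by
    rw [e2, e3]
    unfold StateSpace.transfer
    simp only [Matrix.mulVec_add, Matrix.add_mulVec, ← Matrix.mulVec_mulVec]
    abel
  rw [liftedDFT_eq hF hL y k, liftedDFT_eq hF hL v k]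
  unfold transient liftedFRF freqLift
  rw [← hz, ← hζ, ← hY, ← hV, ← hδ, e4, Matrix.mulVec_add, smul_add,
    Matrix.mulVec_smul _ (1 / (Real.sqrt (F * L : ℕ) : ℂ)), Matrix.mulVec_mulVec _ _ (modulation F ι z), Matrix.mul_assoc _ _ (modulation F ι z),
    inv_modulation_mul hF ι hz0, Matrix.mul_one, Matrix.mulVec_mulVec]

/-! ## Random matrices -/

section Random

variable {Ω : Type*} [MeasurableSpace Ω] {ℙ : Measure Ω} {l m n : Type*}

/-- All entries of the random matrix are integrable. -/
def EntryIntegrable (ℙ : Measure Ω) (X : Ω → Matrix m n ℂ) : Prop :=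
  ∀ i j, Integrable (fun ω => X ω i j) ℙ

theorem EntryIntegrable.sub {X Y : Ω → Matrix m n ℂ} (hX : EntryIntegrable ℙ X)
    (hY : EntryIntegrable ℙ Y) : EntryIntegrable ℙ fun ω => X ω - Y ω :=
  fun i j => (hX i j).sub (hY i j)

theorem EntryIntegrable.add {X Y : Ω → Matrix m n ℂ} (hX : EntryIntegrable ℙ X)
    (hY : EntryIntegrable ℙ Y) : EntryIntegrable ℙ fun ω => X ω + Y ω :=
  fun i j => (hX i j).add (hY i j)

theorem entryIntegrable_const [IsFiniteMeasure ℙ] (A : Matrix m n ℂ) :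
    EntryIntegrable ℙ fun _ => A := fun _ _ => integrable_const _

theorem EntryIntegrable.mul_const [Fintype n] {X : Ω → Matrix m n ℂ} (hX : EntryIntegrable ℙ X)
    (B : Matrix n l ℂ) : EntryIntegrable ℙ fun ω => X ω * B := fun i j => by
  simp only [Matrix.mul_apply]
  exact integrable_finsetSum _ fun k _ => (hX i k).mul_const _

theorem EntryIntegrable.const_mul [Fintype m] {X : Ω → Matrix m n ℂ} (hX : EntryIntegrable ℙ X)
    (B : Matrix l m ℂ) : EntryIntegrable ℙ fun ω => B * X ω := fun i j => by
  simp only [Matrix.mul_apply]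
  exact integrable_finsetSum _ fun k _ => (hX k j).const_mul _

theorem expect_sub {X Y : Ω → Matrix m n ℂ} (hX : EntryIntegrable ℙ X)
    (hY : EntryIntegrable ℙ Y) :
    expect ℙ (fun ω => X ω - Y ω) = expect ℙ X - expect ℙ Y := by
  ext i j
  exact integral_sub (hX i j) (hY i j)

theorem expect_add {X Y : Ω → Matrix m n ℂ} (hX : EntryIntegrable ℙ X)
    (hY : EntryIntegrable ℙ Y) :
    expect ℙ (fun ω => X ω + Y ω) = expect ℙ X + expect ℙ Y := by
  ext i j
  exact integral_add (hX i j) (hY i j)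

theorem expect_const [IsProbabilityMeasure ℙ] (A : Matrix m n ℂ) :
    expect ℙ (fun _ => A) = A := by
  ext i j
  simp [expect]

theorem expect_mul_const [Fintype n] {X : Ω → Matrix m n ℂ} (hX : EntryIntegrable ℙ X)
    (B : Matrix n l ℂ) : expect ℙ (fun ω => X ω * B) = expect ℙ X * B := by
  ext i j
  simp only [expect, Matrix.of_apply, Matrix.mul_apply]
  rw [integral_finsetSum _ fun k _ => (hX i k).mul_const _]
  exact Finset.sum_congr rfl fun k _ => integral_mul_const _ _

theorem expect_const_mul [Fintype m] {X : Ω → Matrix m n ℂ} (hX : EntryIntegrable ℙ X)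
    (B : Matrix l m ℂ) : expect ℙ (fun ω => B * X ω) = B * expect ℙ X := by
  ext i j
  simp only [expect, Matrix.of_apply, Matrix.mul_apply]
  rw [integral_finsetSum _ fun k _ => (hX k j).const_mul _]
  exact Finset.sum_congr rfl fun k _ => integral_const_mul _ _

variable [Fintype m] [Fintype n]

theorem norm_expect_le {X : Ω → Matrix m n ℂ} (hX : EntryIntegrable ℙ X) {g : Ω → ℝ}
    (hg : Integrable g ℙ) (h : ∀ᵐ ω ∂ℙ, ‖X ω‖ ≤ g ω) : ‖expect ℙ X‖ ≤ ∫ ω, g ω ∂ℙ := by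
  refine norm_le_of_sum_norm_row_le _ (integral_nonneg_of_ae ?_) fun i => ?_
  · filter_upwards [h] with ω hω using (norm_nonneg _).trans hω
  · calc ∑ j, ‖expect ℙ X i j‖ ≤ ∑ j, ∫ ω, ‖X ω i j‖ ∂ℙ :=
          Finset.sum_le_sum fun j _ => norm_integral_le_integral_norm _
      _ = ∫ ω, ∑ j, ‖X ω i j‖ ∂ℙ := (integral_finsetSum _ fun j _ => (hX i j).norm).symm
      _ ≤ ∫ ω, g ω ∂ℙ := by
          refine integral_mono_ae (integrable_finsetSum _ fun j _ => (hX i j).norm) hg ?_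
          filter_upwards [h] with ω hω using (sum_norm_row_le _ i).trans hω

/-- The norm is a finite supremum of finite sums of entry norms, so measurability of the entries
suffices. -/
theorem aestronglyMeasurable_norm_matrix {X : Ω → Matrix m n ℂ}
    (hX : ∀ i j, AEStronglyMeasurable (fun ω => X ω i j) ℙ) :
    AEStronglyMeasurable (fun ω => ‖X ω‖) ℙ := by
  have h : ∀ s : Finset m,
      AEStronglyMeasurable (fun ω => s.sup fun i => ∑ j, ‖X ω i j‖₊) ℙ := by
    classical
    intro s
    induction s using Finset.induction_on with
    | empty => simpa using aestronglyMeasurable_const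
    | insert i s _ ih =>
      simp only [Finset.sup_insert]
      exact (Finset.aestronglyMeasurable_fun_sum _ fun j _ =>
        (hX i j).nnnorm).sup ih
  simp only [Matrix.linfty_opNorm_def]
  exact NNReal.continuous_coe.comp_aestronglyMeasurable (h Finset.univ)

omit [Fintype m] in
theorem aestronglyMeasurable_matrix_mul {X : Ω → Matrix m n ℂ} {Y : Ω → Matrix n l ℂ}
    (hX : ∀ i j, AEStronglyMeasurable (fun ω => X ω i j) ℙ)
    (hY : ∀ i j, AEStronglyMeasurable (fun ω => Y ω i j) ℙ) (i : m) (j : l) :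
    AEStronglyMeasurable (fun ω => (X ω * Y ω) i j) ℙ := by
  simp only [Matrix.mul_apply]
  exact Finset.aestronglyMeasurable_fun_sum _ fun k _ => (hX i k).mul (hY k j)

variable [DecidableEq n]

omit [Fintype m] in
theorem aestronglyMeasurable_matrix_det {X : Ω → Matrix n n ℂ}
    (hX : ∀ i j, AEStronglyMeasurable (fun ω => X ω i j) ℙ) :
    AEStronglyMeasurable (fun ω => (X ω).det) ℙ := by
  simp only [Matrix.det_apply']
  exact Finset.aestronglyMeasurable_fun_sum _ fun s _ =>
    (Finset.aestronglyMeasurable_fun_prod _ fun i _ => hX _ _).const_mul _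

omit [Fintype m] in
-- Cramer's rule again. Singular values of `X ω` do no harm, since the scalar inverse is measurable
-- with value 0 at 0.
theorem aestronglyMeasurable_matrix_inv {X : Ω → Matrix n n ℂ}
    (hX : ∀ i j, AEStronglyMeasurable (fun ω => X ω i j) ℙ) (i j : n) :
    AEStronglyMeasurable (fun ω => (X ω)⁻¹ i j) ℙ := by
  simp only [Matrix.inv_def, Matrix.smul_apply, Ring.inverse_eq_inv', smul_eq_mul,
    Matrix.adjugate_apply]
  have h1 := aestronglyMeasurable_matrix_det hX
  have h2 : AEStronglyMeasurable (fun ω => ((X ω).updateRow j (Pi.single i 1)).det) ℙ := by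
    refine aestronglyMeasurable_matrix_det fun a b => ?_
    simp only [Matrix.updateRow_apply]
    split_ifs
    · exact aestronglyMeasurable_const
    · exact hX _ _
  exact h1.aemeasurable.inv.aestronglyMeasurable.mul h2

/-- Bias of the quotient of two random matrices, to first order in their errors. -/
theorem quotient_bias [IsProbabilityMeasure ℙ] {Jh : Ω → Matrix m n ℂ} {Sh : Ω → Matrix n n ℂ}
    {J P : Matrix m n ℂ} {S : Matrix n n ℂ} (hJ : J = P * S) (hS : IsUnit S.det)
    (hJh : EntryIntegrable ℙ Jh) (hSh : EntryIntegrable ℙ Sh)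
    (hinv : ∀ᵐ ω ∂ℙ, IsUnit (Sh ω).det)
    (hint : Integrable (fun ω => ‖(Sh ω)⁻¹‖ * (‖Jh ω - J‖ + ‖Sh ω - S‖) ^ 2) ℙ) :
    EntryIntegrable ℙ (fun ω => Jh ω * (Sh ω)⁻¹) ∧
    ‖expect ℙ (fun ω => Jh ω * (Sh ω)⁻¹) - P -
        ((expect ℙ Jh - J) - P * (expect ℙ Sh - S)) * S⁻¹‖ ≤
      (1 + ‖P‖) * ‖S⁻¹‖ * ∫ ω, ‖(Sh ω)⁻¹‖ * (‖Jh ω - J‖ + ‖Sh ω - S‖) ^ 2 ∂ℙ := by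
  set Lin : Ω → Matrix m n ℂ := fun ω => ((Jh ω - J) - P * (Sh ω - S)) * S⁻¹ with hLin
  set Rem : Ω → Matrix m n ℂ := fun ω => Jh ω * (Sh ω)⁻¹ - (P + Lin ω) with hRem
  have hJd : EntryIntegrable ℙ fun ω => Jh ω - J := hJh.sub (entryIntegrable_const J)
  have hSd : EntryIntegrable ℙ fun ω => Sh ω - S := hSh.sub (entryIntegrable_const S)
  have hnum : EntryIntegrable ℙ fun ω => (Jh ω - J) - P * (Sh ω - S) :=
    hJd.sub (hSd.const_mul P)
  have hLinI : EntryIntegrable ℙ Lin := hnum.mul_const _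
  have hPL : EntryIntegrable ℙ fun ω => P + Lin ω := (entryIntegrable_const P).add hLinI
  have hbound : ∀ᵐ ω ∂ℙ, ‖Rem ω‖ ≤
      (1 + ‖P‖) * ‖S⁻¹‖ * (‖(Sh ω)⁻¹‖ * (‖Jh ω - J‖ + ‖Sh ω - S‖) ^ 2) := by
    filter_upwards [hinv] with ω hω
    -- Because `J = P S`, the numerator equals `Jh - P Sh`, and `S⁻¹ (Sh - S) Sh⁻¹ = S⁻¹ - Sh⁻¹`.
    -- The remainder is thus a product of two factors, each linear in the errors up to an inverse.
    have e : Rem ω = -(((Jh ω - J) - P * (Sh ω - S)) * S⁻¹ * ((Sh ω - S) * (Sh ω)⁻¹)) := by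
      have h1 : S⁻¹ * ((Sh ω - S) * (Sh ω)⁻¹) = S⁻¹ - (Sh ω)⁻¹ := by
        rw [Matrix.sub_mul, Matrix.mul_nonsing_inv _ hω, Matrix.mul_sub, Matrix.mul_one,
          Matrix.nonsing_inv_mul_cancel_left _ _ hS]
      have h2 : (Jh ω - J) - P * (Sh ω - S) = Jh ω - P * Sh ω := by
        rw [hJ, Matrix.mul_sub]
        abel
      simp only [hRem, hLin]
      rw [Matrix.mul_assoc, h1, h2, Matrix.mul_sub, Matrix.sub_mul _ _ (Sh ω)⁻¹,
        Matrix.mul_assoc P (Sh ω), Matrix.mul_nonsing_inv _ hω, Matrix.mul_one]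
      abel
    rw [e, norm_neg]
    refine (Matrix.linfty_opNorm_mul _ _).trans ?_
    have h3 : ‖((Jh ω - J) - P * (Sh ω - S)) * S⁻¹‖ ≤
        ((1 + ‖P‖) * (‖Jh ω - J‖ + ‖Sh ω - S‖)) * ‖S⁻¹‖ := by
      refine (Matrix.linfty_opNorm_mul _ _).trans
        (mul_le_mul_of_nonneg_right ?_ (norm_nonneg _))
      refine (norm_sub_le _ _).trans ?_
      have h4 := Matrix.linfty_opNorm_mul P (Sh ω - S)
      have h5 : 0 ≤ ‖P‖ * ‖Jh ω - J‖ := mul_nonneg (norm_nonneg _) (norm_nonneg _)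
      have h6 : 0 ≤ ‖Sh ω - S‖ := norm_nonneg _
      refine (add_le_add_right h4 _).trans ?_
      linarith
    have h7 : ‖(Sh ω - S) * (Sh ω)⁻¹‖ ≤ (‖Jh ω - J‖ + ‖Sh ω - S‖) * ‖(Sh ω)⁻¹‖ :=
      (Matrix.linfty_opNorm_mul _ _).trans (mul_le_mul_of_nonneg_right
        (le_add_of_nonneg_left (norm_nonneg _)) (norm_nonneg _))
    refine (mul_le_mul h3 h7 (norm_nonneg _) (by positivity)).trans_eq ?_
    ring
  have hg := hint.const_mul ((1 + ‖P‖) * ‖S⁻¹‖)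
  -- Integrability of the quotient is obtained from that of the remainder, which is dominated by the
  -- integrable weighted square.
  have hRemI : EntryIntegrable ℙ Rem := fun i j => by
    refine hg.mono' ?_ ?_
    · exact (aestronglyMeasurable_matrix_mul (fun i j => (hJh i j).aestronglyMeasurable)
        (aestronglyMeasurable_matrix_inv fun i j => (hSh i j).aestronglyMeasurable) i j).sub
          (hPL i j).aestronglyMeasurable
    · filter_upwards [hbound] with ω hω using (norm_entry_le _ i j).trans hω
  have hQ : (fun ω => Jh ω * (Sh ω)⁻¹) = fun ω => Rem ω + (P + Lin ω) := by
    funext ω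
    simp only [hRem, sub_add_cancel]
  refine ⟨?_, ?_⟩
  · rw [hQ]
    exact hRemI.add hPL
  · have e : expect ℙ (fun ω => Jh ω * (Sh ω)⁻¹) - P -
        ((expect ℙ Jh - J) - P * (expect ℙ Sh - S)) * S⁻¹ = expect ℙ Rem := by
      rw [hQ, expect_add hRemI hPL, expect_add (entryIntegrable_const P) hLinI, expect_const,
        hLin, expect_mul_const hnum, expect_sub hJd (hSd.const_mul P), expect_const_mul hSd,
        expect_sub hJh (entryIntegrable_const J), expect_sub hSh (entryIntegrable_const S),
        expect_const, expect_const]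
      abel
    rw [e, ← integral_const_mul]
    exact norm_expect_le hRemI hg hbound

omit [Fintype m] in
/-- If `Sh` is close to the invertible `S`, its inverse is bounded and a weight `‖Sh⁻¹‖` may be
exchanged for `2 ‖S⁻¹‖`. -/
theorem weight_integral_le [IsProbabilityMeasure ℙ] {Sh : Ω → Matrix n n ℂ} {S : Matrix n n ℂ}
    {e : Ω → ℝ} (hS : IsUnit S.det) (hS0 : 0 < ‖S⁻¹‖) (he : AEStronglyMeasurable e ℙ)
    (hinv : ∀ᵐ ω ∂ℙ, IsUnit (Sh ω).det)
    (hint : Integrable (fun ω => ‖(Sh ω)⁻¹‖ * e ω ^ 2) ℙ)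
    (hclose : ∀ᵐ ω ∂ℙ, ‖S⁻¹‖ * ‖Sh ω - S‖ ≤ 1 / 2) :
    ∫ ω, ‖(Sh ω)⁻¹‖ * e ω ^ 2 ∂ℙ ≤ 2 * ‖S⁻¹‖ * ∫ ω, e ω ^ 2 ∂ℙ := by
  -- Only the weighted square is assumed integrable. Since `Sh` stays in a bounded set, `‖Sh⁻¹‖` is
  -- bounded below and the weight can be removed.
  have hI : Integrable (fun ω => e ω ^ 2) ℙ := by
    refine (hint.const_mul (‖S‖ + 1 / 2 / ‖S⁻¹‖)).mono' (he.pow 2) ?_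
    filter_upwards [hinv, hclose] with ω h1 h2
    have h3 : ‖Sh ω - S‖ ≤ 1 / 2 / ‖S⁻¹‖ := by
      rw [le_div_iff₀ hS0, mul_comm]
      exact h2
    have h4 : ‖Sh ω‖ ≤ ‖S‖ + 1 / 2 / ‖S⁻¹‖ := by
      calc ‖Sh ω‖ = ‖S + (Sh ω - S)‖ := by rw [add_sub_cancel]
        _ ≤ ‖S‖ + ‖Sh ω - S‖ := norm_add_le _ _
        _ ≤ _ := by gcongr
    have h5 : ‖S⁻¹‖ ≤ ‖S⁻¹‖ * (‖Sh ω‖ * ‖(Sh ω)⁻¹‖) := by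
      calc ‖S⁻¹‖ = ‖S⁻¹ * (Sh ω * (Sh ω)⁻¹)‖ := by
            rw [Matrix.mul_nonsing_inv _ h1, Matrix.mul_one]
        _ ≤ _ := (Matrix.linfty_opNorm_mul _ _).trans
            (mul_le_mul_of_nonneg_left (Matrix.linfty_opNorm_mul _ _) (norm_nonneg _))
    have h6 : 1 ≤ ‖Sh ω‖ * ‖(Sh ω)⁻¹‖ := le_of_mul_le_mul_left (by rwa [mul_one]) hS0
    have h7 : 1 ≤ (‖S‖ + 1 / 2 / ‖S⁻¹‖) * ‖(Sh ω)⁻¹‖ :=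
      h6.trans (mul_le_mul_of_nonneg_right h4 (norm_nonneg _))
    rw [Real.norm_eq_abs, abs_of_nonneg (sq_nonneg _), ← mul_assoc]
    exact le_mul_of_one_le_left (sq_nonneg _) h7
  rw [← integral_const_mul]
  refine integral_mono_ae hint (hI.const_mul _) ?_
  filter_upwards [hinv, hclose] with ω h1 h2
  refine mul_le_mul_of_nonneg_right ?_ (sq_nonneg _)
  -- The correction term has norm at most half of `‖Sh⁻¹‖` and is absorbed on the left, whence the
  -- factor 2.
  have e1 : (Sh ω)⁻¹ = S⁻¹ - S⁻¹ * ((Sh ω - S) * (Sh ω)⁻¹) := by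
    rw [Matrix.sub_mul, Matrix.mul_nonsing_inv _ h1, Matrix.mul_sub, Matrix.mul_one,
      Matrix.nonsing_inv_mul_cancel_left _ _ hS, sub_sub_cancel]
  have h3 : ‖(Sh ω)⁻¹‖ ≤ ‖S⁻¹‖ + ‖S⁻¹‖ * ‖Sh ω - S‖ * ‖(Sh ω)⁻¹‖ := by
    nth_rewrite 1 [e1]
    refine (norm_sub_le _ _).trans (add_le_add_right ?_ _)
    rw [mul_assoc]
    exact (Matrix.linfty_opNorm_mul _ _).trans
      (mul_le_mul_of_nonneg_left (Matrix.linfty_opNorm_mul _ _) (norm_nonneg _))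
  have h4 := mul_le_mul_of_nonneg_right h2 (norm_nonneg (Sh ω)⁻¹)
  linarith

end Random

/-! ## Noise -/

section Noise

variable {Ω : Type*} [MeasurableSpace Ω] {ℙ : Measure Ω} {F L R n : ℕ} {α ι : Type*} [Fintype α]
  [DecidableEq α]

theorem liftedDFT_add (v w : ℕ → ι → ℝ) :
    liftedDFT F L (fun t => v t + w t) = fun k => liftedDFT F L v k + liftedDFT F L w k := by
  ext k a
  simp only [liftedDFT, dft, Pi.add_apply, Complex.ofReal_add, add_mul, Finset.sum_add_distrib,
    mul_add]

variable {v : ℕ → Ω → ι → ℝ} (hv : ∀ t i, Integrable (fun ω => v t ω i) ℙ)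
include hv

theorem integrable_liftedDFT (k : ℤ) (a : Fin F × ι) :
    Integrable (fun ω => liftedDFT F L (fun t => v t ω) k a) ℙ := by
  simp only [liftedDFT, dft]
  exact (integrable_finsetSum _ fun t _ => (hv t a.2).ofReal.mul_const _).const_mul _

theorem entryIntegrable_lpm_noise (U : ℤ → α → ℂ) (k : ℤ) :
    EntryIntegrable ℙ fun ω => lpm R n U (liftedDFT F L fun t => v t ω) k := fun b a => by
  simp only [lpm_apply]
  exact integrable_finsetSum _ fun i _ => (integrable_liftedDFT hv _ b).mul_const _

/-- The weights are deterministic functions of the excitation, so expectation passes through LPM and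
the DFT to the individual noise samples. No independence is required. -/
theorem expect_lpm_noise (hv0 : ∀ t i, ∫ ω, v t ω i ∂ℙ = 0) (U : ℤ → α → ℂ) (k : ℤ) :
    expect ℙ (fun ω => lpm R n U (liftedDFT F L fun t => v t ω) k) = 0 := by
  have h : ∀ (k : ℤ) (a : Fin F × ι),
      ∫ ω, liftedDFT F L (fun t => v t ω) k a ∂ℙ = 0 := fun k a => by
    simp only [liftedDFT, dft]
    rw [integral_const_mul, integral_finsetSum _ fun t _ => (hv t a.2).ofReal.mul_const _,
      Finset.sum_eq_zero, mul_zero]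
    intro t _
    rw [integral_mul_const, integral_complex_ofReal, hv0, Complex.ofReal_zero, zero_mul]
  ext b a
  simp only [expect, Matrix.of_apply, lpm_apply, Matrix.zero_apply]
  rw [integral_finsetSum _ fun i _ => (integrable_liftedDFT hv _ b).mul_const _]
  exact Finset.sum_eq_zero fun i _ => by rw [integral_mul_const, h, zero_mul]

end Noise

/-! ## The identification experiment -/

namespace Experiment

section

set_option linter.unusedSectionVars false

variable {σ κ μ υ : Type*} [Fintype σ] [DecidableEq σ] [Fintype κ] [DecidableEq κ]
  [Fintype μ] [DecidableEq μ] [Fintype υ] [DecidableEq υ] {F : ℕ} {P : StateSpace σ μ υ}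
  {K : StateSpace κ υ μ} {Ω : Type*} [MeasurableSpace Ω] {ℙ : Measure Ω} {R n : ℕ}

theorem stateGap_eq (E : Experiment F P K ℙ) :
    E.stateGap = Sum.elim (E.x (0 * F)) (E.xK 0) - Sum.elim (E.x (E.L * F)) (E.xK E.L) := by
  unfold stateGap Experiment.N
  rw [zero_mul, mul_comm F]
  ext (i | i) <;> rfl

theorem lpm_noiseless (E : Experiment F P K ℙ) (hF : 0 < F) {o : Type*} [Fintype o]
    [DecidableEq o] (G : StateSpace (σ ⊕ κ) (Fin F × μ) (Fin F × o))
    (hG : ∀ ev ∈ spectrum ℂ (cplx G.A), ‖ev‖ < 1) {y : ℕ → o → ℝ}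
    (hξ : ∀ l, Sum.elim (E.x ((l + 1) * F)) (E.xK (l + 1)) =
      G.A *ᵥ Sum.elim (E.x (l * F)) (E.xK l) + G.B *ᵥ liftSignal F E.r l)
    (hy : ∀ l, liftSignal F y l =
      G.C *ᵥ Sum.elim (E.x (l * F)) (E.xK l) + G.D *ᵥ liftSignal F E.r l)
    {m : ℤ} (hm : Exciting R n E.rLift m) :
    lpm R n E.rLift (liftedDFT F E.L y) m =
      liftedFRF F G (binFreq E.N m) + (E.interp R n G m + E.leak R n G m) := by
  refine lpm_eq_add_errors hm E.N _ (liftedFRF F G) (transient F E.N G E.stateGap) fun k => ?_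
  rw [stateGap_eq]
  exact liftedDFT_response hF E.L_pos G hG hξ hy k

/-- A noisy record yields an integrable estimate whose expectation is the noiseless one. -/
theorem entryIntegrable_lpm [IsProbabilityMeasure ℙ] (E : Experiment F P K ℙ) {o : Type*}
    {y : ℕ → o → ℝ} {v : ℕ → Ω → o → ℝ} (hv : ∀ t i, Integrable (fun ω => v t ω i) ℙ)
    (hv0 : ∀ t i, ∫ ω, v t ω i ∂ℙ = 0) (m : ℤ) :
    EntryIntegrable ℙ (fun ω => lpm R n E.rLift (liftedDFT F E.L fun t => y t + v t ω) m) ∧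
    expect ℙ (fun ω => lpm R n E.rLift (liftedDFT F E.L fun t => y t + v t ω) m) =
      lpm R n E.rLift (liftedDFT F E.L y) m := by
  have h : (fun ω => lpm R n E.rLift (liftedDFT F E.L fun t => y t + v t ω) m) =
      fun ω => lpm R n E.rLift (liftedDFT F E.L y) m +
        lpm R n E.rLift (liftedDFT F E.L fun t => v t ω) m := by
    funext ω
    rw [liftedDFT_add, lpm_add]
  have h1 : EntryIntegrable ℙ fun ω => lpm R n E.rLift (liftedDFT F E.L fun t => v t ω) m :=
    entryIntegrable_lpm_noise hv _ m
  rw [h]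
  exact ⟨(entryIntegrable_const _).add h1, by
    rw [expect_add (entryIntegrable_const _) h1, expect_const, expect_lpm_noise hv hv0, add_zero]⟩

/-- One constant `C` has to dominate both the interpolation and the leakage constant. The improved
leakage order follows by inserting the assumed bound on the relative transient. -/
theorem errorOrders_of_le (E : Experiment F P K ℙ) (hF : 0 < F) {o : Type*} [Fintype o]
    [DecidableEq o] (G : StateSpace (σ ⊕ κ) (Fin F × μ) (Fin F × o))
    (hG : ∀ ev ∈ spectrum ℂ (cplx G.A), ‖ev‖ < 1) {C CT : ℝ} (hCT0 : 0 ≤ CT)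
    (hCT : ∀ (N : ℕ) (δ : σ ⊕ κ → ℝ) (θ : ℝ) (a : Fin F × o),
      ‖iteratedDeriv (R + 1) (fun θ => transient F N G δ θ a) θ‖ ≤ CT * (‖δ‖ / Real.sqrt N))
    (h1 : Fintype.card (Fin F × μ) * (2 * Real.pi) ^ (R + 1) ≤ C)
    (h2 : (2 * Real.pi) ^ (R + 1) * CT ≤ C) (m : ℤ) : E.ErrorOrders R n G m C := by
  have hIG : 0 ≤ interpGain R n E.rLift m := Finset.sum_nonneg fun i _ => by positivity
  have hLG : 0 ≤ leakGain R n E.rLift m := Finset.sum_nonneg fun i _ => by positivity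
  have hC : 0 ≤ C := le_trans (by positivity) h1
  have hleak : ‖E.leak R n G m‖ ≤
      C * (leakGain R n E.rLift m * ‖E.stateGap‖ / Real.sqrt E.N) *
        ((n : ℝ) / E.N) ^ (R + 1) := by
    refine (norm_leakError_le E.N E.rLift _ m
      (fun b => contDiff_transient E.N G hG E.stateGap b)
      (B := CT * (‖E.stateGap‖ / Real.sqrt E.N)) (by positivity)
      (fun θ b => hCT E.N E.stateGap θ b)).trans ?_
    refine mul_le_mul_of_nonneg_right ?_ (by positivity)
    calc _ = ((2 * Real.pi) ^ (R + 1) * CT) *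
          (leakGain R n E.rLift m * ‖E.stateGap‖ / Real.sqrt E.N) := by ring
      _ ≤ _ := mul_le_mul_of_nonneg_right h2 (by positivity)
  refine ⟨fun b hb => ?_, hleak, fun c hc => hleak.trans ?_⟩
  · have hle : binFreq E.N (m - n) ≤ binFreq E.N (m + n) := by
      unfold binFreq
      push_cast
      gcongr
      linarith [(Nat.cast_nonneg n : (0 : ℝ) ≤ n)]
    have hb0 : 0 ≤ b := (norm_nonneg _).trans (hb _ (Set.left_mem_Icc.2 hle))
    refine (norm_interpError_le E.N E.rLift (liftedFRF F G) m
      (fun a b => contDiff_liftedFRF hF G hG a b) b hb).trans ?_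
    gcongr
  · rw [pow_succ _ (R + 1), mul_comm (((n : ℝ) / E.N) ^ (R + 1)), ← mul_assoc]
    refine mul_le_mul_of_nonneg_right ?_ (by positivity)
    rw [mul_assoc]
    exact mul_le_mul_of_nonneg_left hc hC

/-- Row sums of a block are partial row sums of the whole matrix. -/
theorem norm_invFreqLift_le (E : Experiment F P K ℙ) (p : Fin F)
    (G : ℤ → Matrix (Fin F × υ) (Fin F × μ) ℂ) (k : ℤ) :
    ‖E.invFreqLift p G k‖ ≤ ‖G (k - (p : ℕ) * E.L)‖ := by
  refine norm_le_of_sum_norm_row_le _ (norm_nonneg _) fun i => ?_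
  refine le_trans ?_ (sum_norm_row_le (G (k - (p : ℕ) * E.L)) (p, i))
  rw [Fintype.sum_prod_type]
  exact Finset.single_le_sum
    (f := fun q => ∑ j, ‖G (k - (p : ℕ) * E.L) (p, i) (q, j)‖)
    (fun q _ => Finset.sum_nonneg fun _ _ => norm_nonneg _) (Finset.mem_univ p)

section Plant

variable (E : Experiment F P K ℙ) (hF : 0 < F) (p : Fin F) {k m : ℤ}
  (hm : m = k - (p : ℕ) * E.L)
  (hA : ∀ f : Fin F, (((circ (binFreq E.N k) * phi F ^ (f : ℕ)) • (1 : Matrix σ σ ℂ) -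
    cplx P.A).det ≠ 0))
include hF hm hA

/-- The shift by `φ ^ (-p)` only permutes the points `z φ ^ f` cyclically; `F - p` stands for `-p`
modulo `F`. -/
theorem det_shifted_ne_zero (f : Fin F) :
    ((circ (binFreq E.N m) * phi F ^ (f : ℕ)) • (1 : Matrix σ σ ℂ) - cplx P.A).det ≠ 0 := by
  have hk : circ (binFreq E.N m) * phi F ^ (p : ℕ) = circ (binFreq E.N k) := by
    unfold Experiment.N
    rw [circ_binFreq_mul_phi_pow hF E.L_pos, hm, sub_add_cancel]
  have hφ : phi F ^ F = 1 := (isPrimitiveRoot_phi hF).pow_eq_one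
  have h1 : circ (binFreq E.N m) * phi F ^ (f : ℕ) =
      circ (binFreq E.N k) * phi F ^ (((f : ℕ) + (F - p)) % F) := by
    rw [← hk, ← pow_eq_pow_mod _ hφ, mul_assoc, ← pow_add,
      show (p : ℕ) + ((f : ℕ) + (F - p)) = f + F by omega, pow_add, hφ, mul_one]
  rw [h1]
  exact hA ⟨_, Nat.mod_lt _ hF⟩

theorem invFreqLift_PTrue : E.invFreqLift p E.PTrue k = P.transfer (circ (binFreq E.N k)) := by
  ext i j
  have hk : circ (binFreq E.N m) * phi F ^ (p : ℕ) = circ (binFreq E.N k) := by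
    unfold Experiment.N
    rw [circ_binFreq_mul_phi_pow hF E.L_pos, hm, sub_add_cancel]
  simp only [invFreqLift, Matrix.of_apply, PTrue, liftedFRF, ← hm]
  rw [freqLift_timeLift hF P (circ_ne_zero _) (det_shifted_ne_zero E hF p hm hA)]
  simp [hk]

/-- Stability is needed for the closed loop only. The plant may be unstable, as long as `z ^ F` is
not an eigenvalue of `P.A ^ F`. -/
theorem JTrue_eq_mul (hstab : Stabilizes F P K) : E.JTrue m = E.PTrue m * E.STrue m := by
  have hz := circ_ne_zero (binFreq E.N m)
  refine freqLift_eq_mul hF hz (transfer_processSensitivity _ _ _ ?_ ?_)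
  · have := det_pow_smul_one_sub_pow_ne_zero hF (cplx P.A) hz
      (det_shifted_ne_zero E hF p hm hA)
    rwa [← cplx_pow] at this
  · exact det_circ_pow_ne_zero hstab F _

end Plant

theorem biasFormula_congr (E : Experiment F P K ℙ) (p : Fin F)
    {JΔ JΔ' : ℤ → Matrix (Fin F × υ) (Fin F × μ) ℂ}
    {SΔ SΔ' : ℤ → Matrix (Fin F × μ) (Fin F × μ) ℂ} {k : ℤ}
    (hJ : JΔ (k - (p : ℕ) * E.L) = JΔ' (k - (p : ℕ) * E.L))
    (hS : SΔ (k - (p : ℕ) * E.L) = SΔ' (k - (p : ℕ) * E.L)) :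
    E.biasFormula p JΔ SΔ k = E.biasFormula p JΔ' SΔ' k := by
  ext i j
  simp only [biasFormula, invFreqLift, hJ, hS]

end

end Experiment

end Multirate

/-! ### Proof of the bias theorem -/

open Multirate in
theorem mainTheorem3 {σ κ μ υ : Type*} [Fintype σ] [DecidableEq σ] [Fintype κ] [DecidableEq κ]
    [Fintype μ] [DecidableEq μ] [Fintype υ] [DecidableEq υ]
    (F : ℕ) (hF : 0 < F) (P : StateSpace σ μ υ) (K : StateSpace κ υ μ)
    (hwell : IsUnit (1 + K.D * P.D).det) (hstab : Stabilizes F P K) (R : ℕ) :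
    ∃ C : ℝ, ∀ {Ω : Type*} [MeasurableSpace Ω] (ℙ : Measure Ω) [IsProbabilityMeasure ℙ]
      (E : Experiment F P K ℙ) (n : ℕ) (p : Fin F),
      -- the bias formula at all frequencies for which the estimate is defined
      (∀ k m : ℤ, m = k - (p : ℕ) * E.L → Exciting R n E.rLift m →
        -- the LPM bias of the lifted systems is interpolation plus leakage error
        ((∀ a b, Integrable (fun ω => E.JHat R n ω m a b) ℙ) ∧
          (∀ a b, Integrable (fun ω => E.SHat R n ω m a b) ℙ) ∧
          expect ℙ (fun ω => E.JHat R n ω m) - E.JTrue m = E.JDelta R n m ∧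
          expect ℙ (fun ω => E.SHat R n ω m) - E.STrue m = E.SDelta R n m ∧
          E.ErrorOrders R n (liftedJ F P K) m C ∧
          E.ErrorOrders R n (liftedS F P K) m C) ∧
        -- the bias of the high-rate plant
        ((∀ f : Fin F, (((circ (binFreq E.N k) * phi F ^ (f : ℕ)) • (1 : Matrix σ σ ℂ) -
            cplx P.A).det ≠ 0)) →
          IsUnit (E.STrue m).det →
          (∀ᵐ ω ∂ℙ, IsUnit (E.SHat R n ω m).det) →
          Integrable (fun ω => ‖(E.SHat R n ω m)⁻¹‖ * E.lpmErr R n ω m ^ 2) ℙ →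
          (∀ i j, Integrable (fun ω => E.PhHat R n p ω k i j) ℙ) ∧
          ‖expect ℙ (fun ω => E.PhHat R n p ω k) - P.transfer (circ (binFreq E.N k)) -
              E.biasFormula p (E.JDelta R n) (E.SDelta R n) k‖ ≤
            (1 + ‖E.PTrue m‖) * ‖(E.STrue m)⁻¹‖ *
              ∫ ω, ‖(E.SHat R n ω m)⁻¹‖ * E.lpmErr R n ω m ^ 2 ∂ℙ ∧
          ((∀ᵐ ω ∂ℙ, ‖(E.STrue m)⁻¹‖ * ‖E.SHat R n ω m - E.STrue m‖ ≤ 1 / 2) →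
            ‖expect ℙ (fun ω => E.PhHat R n p ω k) - P.transfer (circ (binFreq E.N k)) -
                E.biasFormula p (E.JDelta R n) (E.SDelta R n) k‖ ≤
              2 * (1 + ‖E.PTrue m‖) * ‖(E.STrue m)⁻¹‖ ^ 2 *
                ∫ ω, E.lpmErr R n ω m ^ 2 ∂ℙ))) ∧
      -- lifted errors at a single frequency affect the plant at a single frequency only
      (∀ (JΔ : ℤ → Matrix (Fin F × υ) (Fin F × μ) ℂ) (SΔ : ℤ → Matrix (Fin F × μ) (Fin F × μ) ℂ)
        (m : ℤ),
        (∀ m' : ℤ, ¬ m' ≡ m [ZMOD E.N] → JΔ m' = E.JDelta R n m' ∧ SΔ m' = E.SDelta R n m') →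
        ∀ k : ℤ, ¬ k ≡ m + (p : ℕ) * E.L [ZMOD E.N] →
          E.biasFormula p JΔ SΔ k = E.biasFormula p (E.JDelta R n) (E.SDelta R n) k) := by
  -- Both closed-loop systems have the same transition matrix by definition.
  have hstabJ : ∀ ev ∈ spectrum ℂ (cplx (liftedJ F P K).A), ‖ev‖ < 1 := hstab
  obtain ⟨CS, hCS0, hCS⟩ := exists_norm_iteratedDeriv_transient_le (liftedS F P K) hstab (R + 1)
  obtain ⟨CJ, hCJ0, hCJ⟩ := exists_norm_iteratedDeriv_transient_le (liftedJ F P K) hstabJ (R + 1)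
  have hpi : (0 : ℝ) ≤ (2 * Real.pi) ^ (R + 1) := by positivity
  have hcard : (0 : ℝ) ≤ Fintype.card (Fin F × μ) := Nat.cast_nonneg _
  -- The power of `2π` converts `n/N` into a frequency distance. The three summands serve the
  -- interpolation errors and the leakage errors of `S` and `J`; all are fixed before the experiment
  -- is.
  refine ⟨(2 * Real.pi) ^ (R + 1) * (Fintype.card (Fin F × μ) + CS + CJ), ?_⟩
  have hC1 : Fintype.card (Fin F × μ) * (2 * Real.pi) ^ (R + 1) ≤
      (2 * Real.pi) ^ (R + 1) * (Fintype.card (Fin F × μ) + CS + CJ) := by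
    rw [mul_comm]
    exact mul_le_mul_of_nonneg_left (by linarith) hpi
  have hC2 : (2 * Real.pi) ^ (R + 1) * CS ≤
      (2 * Real.pi) ^ (R + 1) * (Fintype.card (Fin F × μ) + CS + CJ) :=
    mul_le_mul_of_nonneg_left (by linarith) hpi
  have hC3 : (2 * Real.pi) ^ (R + 1) * CJ ≤
      (2 * Real.pi) ^ (R + 1) * (Fintype.card (Fin F × μ) + CS + CJ) :=
    mul_le_mul_of_nonneg_left (by linarith) hpi
  intro Ω _ ℙ _ E n p
  refine ⟨fun k m hm hexc => ?_, fun JΔ SΔ m h k hk => ?_⟩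
  · have heq := E.lifted_equations hF hwell
    obtain ⟨hSI, hSE⟩ : EntryIntegrable ℙ (fun ω => E.SHat R n ω m) ∧
        expect ℙ (fun ω => E.SHat R n ω m) = lpm R n E.rLift (liftedDFT F E.L E.u) m :=
      E.entryIntegrable_lpm E.vu_integrable E.vu_mean m
    obtain ⟨hJI, hJE⟩ : EntryIntegrable ℙ (fun ω => E.JHat R n ω m) ∧
        expect ℙ (fun ω => E.JHat R n ω m) = lpm R n E.rLift (liftedDFT F E.L E.y) m :=
      E.entryIntegrable_lpm E.vy_integrable E.vy_mean m
    have hSbias : expect ℙ (fun ω => E.SHat R n ω m) - E.STrue m = E.SDelta R n m := by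
      rw [hSE, sub_eq_iff_eq_add']
      exact E.lpm_noiseless hF (liftedS F P K) hstab (fun l => (heq l).1)
        (fun l => (heq l).2.1) hexc
    have hJbias : expect ℙ (fun ω => E.JHat R n ω m) - E.JTrue m = E.JDelta R n m := by
      rw [hJE, sub_eq_iff_eq_add']
      exact E.lpm_noiseless hF (liftedJ F P K) hstabJ (fun l => (heq l).1)
        (fun l => (heq l).2.2) hexc
    refine ⟨⟨hJI, hSI, hJbias, hSbias, E.errorOrders_of_le hF _ hstabJ hCJ0 hCJ hC1 hC3 m,
      E.errorOrders_of_le hF _ hstab hCS0 hCS hC1 hC2 m⟩, fun hA hS hinv hint => ?_⟩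
    obtain ⟨hQI, hQ⟩ := quotient_bias (E.JTrue_eq_mul hF p hm hA hstab) hS hJI hSI hinv hint
    rw [hSbias, hJbias] at hQ
    -- Expectation and subtraction act entrywise, so they commute with taking the diagonal block.
    have hblock : expect ℙ (fun ω => E.PhHat R n p ω k) - P.transfer (circ (binFreq E.N k)) -
        E.biasFormula p (E.JDelta R n) (E.SDelta R n) k =
        E.invFreqLift p (fun m => expect ℙ (fun ω => E.PHat R n ω m) - E.PTrue m -
          (E.JDelta R n m - E.PTrue m * E.SDelta R n m) * (E.STrue m)⁻¹) k := by
      rw [← E.invFreqLift_PTrue hF p hm hA]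
      rfl
    have hbound := hblock ▸ E.norm_invFreqLift_le p (fun m =>
      expect ℙ (fun ω => E.PHat R n ω m) - E.PTrue m -
        (E.JDelta R n m - E.PTrue m * E.SDelta R n m) * (E.STrue m)⁻¹) k
    rw [← hm] at hbound
    have hmain := hbound.trans hQ
    refine ⟨fun i j => ?_, hmain, fun hclose => hmain.trans ?_⟩
    · have := hQI (p, i) (p, j)
      rw [hm] at this
      exact this
    -- An invertible matrix whose inverse has norm zero is empty; in this degenerate case both
    -- bounds are 0.
    · rcases (norm_nonneg (E.STrue m)⁻¹).eq_or_lt with h0 | h0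
      · rw [← h0]
        simp
      · have herr : AEStronglyMeasurable (fun ω => E.lpmErr R n ω m) ℙ :=
          (aestronglyMeasurable_norm_matrix fun i j =>
            (hJI.sub (entryIntegrable_const (E.JTrue m)) i j).aestronglyMeasurable).add
          (aestronglyMeasurable_norm_matrix fun i j =>
            (hSI.sub (entryIntegrable_const (E.STrue m)) i j).aestronglyMeasurable)
        have hw := weight_integral_le hS h0 herr hinv hint hclose
        calc _ ≤ (1 + ‖E.PTrue m‖) * ‖(E.STrue m)⁻¹‖ *
              (2 * ‖(E.STrue m)⁻¹‖ * ∫ ω, E.lpmErr R n ω m ^ 2 ∂ℙ) :=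
              mul_le_mul_of_nonneg_left hw
                (mul_nonneg (add_nonneg zero_le_one (norm_nonneg _)) (norm_nonneg _))
          _ = _ := by ring
  -- The formula at `k` reads the lifted errors only at `k - pL`, which is congruent to `m` exactly
  -- when `k` is congruent to `m + pL`.
  · have hk' : ¬ k - (p : ℕ) * E.L ≡ m [ZMOD E.N] := fun hc => hk (by
      simpa using hc.add_right ((p : ℕ) * E.L : ℤ))
    exact E.biasFormula_congr p (h _ hk').1 (h _ hk').2
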